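/- Let $R$ be a commutative ring with identity and let $C$ be a semidualizing $R$-module: $C$ has a projective resolution by finitely generated projective modules, the homothety map $R\to \mathrm{Hom}_R(C,C)$ is an isomorphism, and $\mathrm{Ext}^i_R(C,C)=0$ for all $i\ge 1$. Consider the following classes of $R$-modules. - $\mathcal G(\mathcal F)$, the Gorenstein flat modules: those $M$ for which there is an exact sequence $\mathbb X=\cdots\to F_1\to F_0\to F^0\to F^1\to\cdots$ of flat $R$-modules such that $M\cong\mathrm{im}(F_0\to F^0)$ and $I\otimes_R\mathbb X$ is exact for every injective $R$-module $I$. - $\mathcal A_C(R)$, the Auslander class: those $M$ such that $\mathrm{Tor}^R_i(C,M)=0=\mathrm{Ext}_R^i(C,C\otimes_R M)$ for all $i\ge1$ and the natural map $M\to\mathrm{Hom}_R(C,C\otimes_R M)$, $m\mapsto(c\mapsto c\otimes m)$, is an isomorphism. - $\mathcal G(\mathcal W_F)$, the $\mathcal W_F$-Gorenstein modules: those $M$ for which there is an exact sequence $\mathbb W=\cdots\to W_1\to W_0\to W^0\to W^1\to\cdots$ such that each $W_i$ and each $W^i$ is isomorphic to $C\otimes_R F$ for some flat $R$-module $F$ (depending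 on the term), $M\cong\mathrm{im}(W_0\to W^0)$, the sequence $\mathrm{Hom}_R(C\otimes_R P,\mathbb W)$ is exact for every projective $R$-module $P$, and the sequence $\mathrm{Hom}_R(C,I)\otimes_R\mathbb W$ is exact for every injective $R$-module $I$. Regard $\mathcal G(\mathcal F)\cap\mathcal A_C(R)$ and $\mathcal G(\mathcal W_F)$ as full subcategories of the category of $R$-modules. Then $C\otimes_R-$ maps $\mathcal G(\mathcal F)\cap\mathcal A_C(R)$ into $\mathcal G(\mathcal W_F)$, $\mathrm{Hom}_R(C,-)$ maps $\mathcal G(\mathcal W_F)$ into $\mathcal G(\mathcal F)\cap\mathcal A_C(R)$, and these restricted functors are mutually quasi-inverse equivalences of categories $$C\otimes_R-\;:\;\mathcal G(\mathcal F)\cap\mathcal A_C(R)\;\rightleftarrows\;\mathcal G(\mathcal W_F)\;:\;\mathrm{Hom}_R(C,-).$$ -/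

import Mathlib

open CategoryTheory
open scoped TensorProduct

universe u

namespace Foxby

variable {R : Type u} [CommRing R]

/-- The functor `X ⊗_R -` on `R`-modules. -/
noncomputable abbrev tensorFunctor (X : ModuleCat.{u} R) : ModuleCat.{u} R ⥤ ModuleCat.{u} R :=
  MonoidalCategory.tensorLeft X

/-- The functor `Hom_R(X, -)` from `R`-modules to `R`-modules. -/
abbrev homFunctor (X : ModuleCat.{u} R) : ModuleCat.{u} R ⥤ ModuleCat.{u} R :=
  (linearCoyoneda R (ModuleCat.{u} R)).obj (Opposite.op X)

/-- `Ext_R^i(M, N) = 0` for all `i ≥ 1`. -/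
def ExtVanish (M N : ModuleCat.{u} R) : Prop :=
  ∀ i : ℕ, 1 ≤ i → Subsingleton (Abelian.Ext.{u} M N i)

/-- `Tor^R_i(M, N) = 0` for all `i ≥ 1`. -/
def TorVanish (M N : ModuleCat.{u} R) : Prop :=
  ∀ i : ℕ, 1 ≤ i → Limits.IsZero (((Tor (ModuleCat.{u} R) i).obj M).obj N)

/-- Semidualizing modules over a commutative ring. -/
structure IsSemidualizing (C : ModuleCat.{u} R) : Prop where
  /-- there is a projective resolution by finitely generated projective modules -/
  resolution : ∃ P : ProjectiveResolution C, ∀ n : ℕ, Module.Finite R (P.complex.X n)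
  /-- the homothety map `R → Hom_R(C, C)` is an isomorphism -/
  homothety : Function.Bijective (LinearMap.lsmul R C : R →ₗ[R] C →ₗ[R] C)
  ext_vanish : ExtVanish C C

/-- The Auslander class `A_C(R)`. The last condition is that the natural evaluation map
`M → Hom_R(C, C ⊗_R M)`, `m ↦ (c ↦ c ⊗ m)`, is an isomorphism. -/
def auslanderClass (C : ModuleCat.{u} R) : ObjectProperty (ModuleCat.{u} R) := fun M =>
  TorVanish C M ∧ ExtVanish C ((tensorFunctor C).obj M) ∧
    Function.Bijective ((TensorProduct.mk R C M).flip : M →ₗ[R] C →ₗ[R] C ⊗[R] M)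

/-- `C`-projective modules: `C ⊗_R P` with `P` projective. -/
def cProjective (C : ModuleCat.{u} R) : ObjectProperty (ModuleCat.{u} R) := fun X =>
  ∃ P : ModuleCat.{u} R, Module.Projective R P ∧ Nonempty (X ≃ₗ[R] C ⊗[R] P)

/-- `C`-flat modules: `C ⊗_R F` with `F` flat. -/
def cFlat (C : ModuleCat.{u} R) : ObjectProperty (ModuleCat.{u} R) := fun X =>
  ∃ F : ModuleCat.{u} R, Module.Flat R F ∧ Nonempty (X ≃ₗ[R] C ⊗[R] F)

/-- `C`-injective modules: `Hom_R(C, I)` with `I` injective. -/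
def cInjective (C : ModuleCat.{u} R) : ObjectProperty (ModuleCat.{u} R) := fun X =>
  ∃ I : ModuleCat.{u} R, Module.Injective R I ∧ Nonempty (X ≃ₗ[R] (C →ₗ[R] I))

/-- The complex `K` stays exact after applying the additive functor `F`. -/
def ExactAfter (F : ModuleCat.{u} R ⥤ ModuleCat.{u} R) [F.Additive]
    (K : CochainComplex (ModuleCat.{u} R) ℤ) : Prop :=
  ((F.mapHomologicalComplex (ComplexShape.up ℤ)).obj K).Acyclic

/-- Gorenstein flat modules. The doubly infinite sequence
`⋯ → F₁ → F₀ → F⁰ → F¹ → ⋯` is indexed by `ℤ` with `Fⁿ` in degree `n` and `Fₙ` in degree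
`-n - 1`, so that `F₀ → F⁰` is the differential from degree `-1` to degree `0`. -/
def gorensteinFlat (R : Type u) [CommRing R] : ObjectProperty (ModuleCat.{u} R) := fun M =>
  ∃ K : CochainComplex (ModuleCat.{u} R) ℤ,
    K.Acyclic ∧ (∀ n : ℤ, Module.Flat R (K.X n)) ∧
    Nonempty (M ≃ₗ[R] LinearMap.range (K.d (-1) 0).hom) ∧
    ∀ I : ModuleCat.{u} R, Module.Injective R I → ExactAfter (tensorFunctor I) K

/-- `W_F`-Gorenstein modules (with respect to `C`), with the same indexing as for
`gorensteinFlat`. -/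
def wfGorenstein (C : ModuleCat.{u} R) : ObjectProperty (ModuleCat.{u} R) := fun M =>
  ∃ K : CochainComplex (ModuleCat.{u} R) ℤ,
    K.Acyclic ∧ (∀ n : ℤ, cFlat C (K.X n)) ∧
    Nonempty (M ≃ₗ[R] LinearMap.range (K.d (-1) 0).hom) ∧
    (∀ X : ModuleCat.{u} R, cProjective C X → ExactAfter (homFunctor X) K) ∧
    ∀ J : ModuleCat.{u} R, cInjective C J → ExactAfter (tensorFunctor J) K

end Foxby

/-! The unit M → Hom(C, C ⊗ M) and the counit C ⊗ Hom(C, N) → N of the tensor-hom adjunction are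
natural, so the task is to make them bijective on the two classes and to carry the defining
complexes across.

All input from C on single modules comes from one exact sequence 0 → R → Hom(P, C) → Hom(Q, C),
where Q → P → C → 0 is a finite projective presentation. Tensoring it with a flat F makes the unit
at F bijective; applying Hom(-, I) with I injective makes the counit at I bijective. Hence flat and
C-flat terms correspond, and Hom(C, I) ⊗ C ≅ I matches the two tensor-exactness conditions.

For a flat complex K the issue is exactness of C ⊗ K. Cycles to the right of M stay in the Auslander
class, which is closed under cokernels of injections (`IsSemidualizing.auslanderClass_X₃`); to the
left, Tor-vanishing passes to kernels. The closure rests on `IsSemidualizing.lTensor_injective`: the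
kernel Z of C ⊗ f has Hom(C, Z) = 0, and a finitely generated faithful module maps nontrivially to
every nonzero module.

For a C-flat complex W, Hom(C, W) is exact because C itself is C-projective. A chase makes the
counit bijective on all cycles, and dimension shifting gives Tor-vanishing from the left and
Ext-vanishing from the right. -/

namespace Foxby

variable {R : Type u} [CommRing R]

/-! ### Ext-vanishing in short exact sequences -/

section Ext

variable {X Y : ModuleCat.{u} R}

theorem subsingleton_ext_succ_iff (P : ProjectiveResolution X) (i : ℕ) :
    Subsingleton (Abelian.Ext.{u} X Y (i + 1)) ↔
      ∀ f : P.complex.X (i + 1) ⟶ Y, P.complex.d (i + 2) (i + 1) ≫ f = 0 →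
        ∃ g : P.complex.X i ⟶ Y, P.complex.d (i + 1) i ≫ g = f := by
  constructor
  · intro h f hf
    exact (P.extMk_eq_zero_iff f (i + 2) rfl hf i rfl).1 (Subsingleton.elim _ _)
  · intro h
    refine subsingleton_of_forall_eq 0 fun α => ?_
    obtain ⟨f, hf, rfl⟩ := P.extMk_surjective α (i + 2) rfl
    exact (P.extMk_eq_zero_iff f (i + 2) rfl hf i rfl).2 (h f hf)

theorem extVanish_iff_succ :
    ExtVanish X Y ↔ ∀ i : ℕ, Subsingleton (Abelian.Ext.{u} X Y (i + 1)) :=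
  ⟨fun h i => h (i + 1) (by lia), fun h i hi => by
    obtain ⟨j, rfl⟩ := Nat.exists_eq_add_of_le' hi
    exact h j⟩

theorem ExtVanish.of_iso {Y' : ModuleCat.{u} R} (e : Y ≅ Y') (h : ExtVanish X Y) :
    ExtVanish X Y' := by
  intro i hi
  have := h i hi
  refine subsingleton_of_forall_eq 0 fun α => ?_
  have h0 : α.comp (Abelian.Ext.mk₀ e.inv) (add_zero i) = 0 := Subsingleton.elim _ _
  have h1 := congrArg (fun β => β.comp (Abelian.Ext.mk₀ e.hom) (add_zero i)) h0
  simpa using h1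

variable {S : ShortComplex (ModuleCat.{u} R)} (hS : S.ShortExact)

include hS

theorem subsingleton_ext_left_X₁ (i : ℕ) (h₂ : Subsingleton (Abelian.Ext.{u} S.X₂ Y i))
    (h₃ : Subsingleton (Abelian.Ext.{u} S.X₃ Y (i + 1))) :
    Subsingleton (Abelian.Ext.{u} S.X₁ Y i) := by
  refine subsingleton_of_forall_eq 0 fun α => ?_
  obtain ⟨β, rfl⟩ := Abelian.Ext.contravariant_sequence_exact₁ hS (Y := Y) α
    (n₁ := i + 1) (add_comm _ _) (Subsingleton.elim _ _)
  rw [Subsingleton.elim β 0, Abelian.Ext.comp_zero]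

theorem subsingleton_ext_left_X₃ (i : ℕ) (h₁ : Subsingleton (Abelian.Ext.{u} S.X₁ Y i))
    (h₂ : Subsingleton (Abelian.Ext.{u} S.X₂ Y (i + 1))) :
    Subsingleton (Abelian.Ext.{u} S.X₃ Y (i + 1)) := by
  refine subsingleton_of_forall_eq 0 fun α => ?_
  obtain ⟨β, rfl⟩ := Abelian.Ext.contravariant_sequence_exact₃ hS (Y := Y) α
    (Subsingleton.elim _ _) (n₀ := i) (add_comm _ _)
  rw [Subsingleton.elim β 0, Abelian.Ext.comp_zero]

theorem subsingleton_ext_one_left_X₃ (h : ∀ f : S.X₁ ⟶ Y, ∃ g : S.X₂ ⟶ Y, S.f ≫ g = f)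
    (h₂ : Subsingleton (Abelian.Ext.{u} S.X₂ Y 1)) :
    Subsingleton (Abelian.Ext.{u} S.X₃ Y 1) := by
  refine subsingleton_of_forall_eq 0 fun α => ?_
  obtain ⟨β, rfl⟩ := Abelian.Ext.contravariant_sequence_exact₃ hS (Y := Y) α
    (Subsingleton.elim _ _) (n₀ := 0) rfl
  obtain ⟨f, rfl⟩ := (Abelian.Ext.mk₀_bijective _ _).2 β
  obtain ⟨g, rfl⟩ := h f
  rw [← Abelian.Ext.mk₀_comp_mk₀, ← Abelian.Ext.comp_assoc _ _ _ rfl (add_zero 0) (by simp)]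
  simp

theorem exists_extension_of_subsingleton_ext
    (h₃ : Subsingleton (Abelian.Ext.{u} S.X₃ Y 1)) (f : S.X₁ ⟶ Y) :
    ∃ g : S.X₂ ⟶ Y, S.f ≫ g = f := by
  obtain ⟨β, hβ⟩ := Abelian.Ext.contravariant_sequence_exact₁ hS (Y := Y) (Abelian.Ext.mk₀ f)
    (n₁ := 1) rfl (Subsingleton.elim _ _)
  obtain ⟨g, rfl⟩ := (Abelian.Ext.mk₀_bijective _ _).2 β
  rw [Abelian.Ext.mk₀_comp_mk₀] at hβ
  exact ⟨g, (Abelian.Ext.mk₀_bijective _ _).1 hβ⟩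

theorem subsingleton_ext_right_X₁ (i : ℕ) (h₂ : Subsingleton (Abelian.Ext.{u} X S.X₂ (i + 1)))
    (h₃ : Subsingleton (Abelian.Ext.{u} X S.X₃ i)) :
    Subsingleton (Abelian.Ext.{u} X S.X₁ (i + 1)) := by
  refine subsingleton_of_forall_eq 0 fun α => ?_
  obtain ⟨β, rfl⟩ := Abelian.Ext.covariant_sequence_exact₁ X hS α
    (Subsingleton.elim _ _) (n₀ := i) rfl
  rw [Subsingleton.elim β 0, Abelian.Ext.zero_comp]

theorem subsingleton_ext_right_X₃ (i : ℕ) (h₁ : Subsingleton (Abelian.Ext.{u} X S.X₁ (i + 1)))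
    (h₂ : Subsingleton (Abelian.Ext.{u} X S.X₂ i)) :
    Subsingleton (Abelian.Ext.{u} X S.X₃ i) := by
  refine subsingleton_of_forall_eq 0 fun α => ?_
  obtain ⟨β, rfl⟩ := Abelian.Ext.covariant_sequence_exact₃ X hS α
    (n₁ := i + 1) rfl (Subsingleton.elim _ _)
  rw [Subsingleton.elim β 0, Abelian.Ext.zero_comp]

theorem subsingleton_ext_one_right_X₁ (h : ∀ f : X ⟶ S.X₃, ∃ g : X ⟶ S.X₂, g ≫ S.g = f)
    (h₂ : Subsingleton (Abelian.Ext.{u} X S.X₂ 1)) :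
    Subsingleton (Abelian.Ext.{u} X S.X₁ 1) := by
  refine subsingleton_of_forall_eq 0 fun α => ?_
  obtain ⟨β, rfl⟩ := Abelian.Ext.covariant_sequence_exact₁ X hS α
    (Subsingleton.elim _ _) (n₀ := 0) rfl
  obtain ⟨f, rfl⟩ := (Abelian.Ext.mk₀_bijective _ _).2 β
  obtain ⟨g, rfl⟩ := h f
  rw [← Abelian.Ext.mk₀_comp_mk₀, Abelian.Ext.comp_assoc _ _ _ (add_zero 0) (zero_add 1) (by simp)]
  simp

theorem exists_lift_of_subsingleton_ext
    (h₁ : Subsingleton (Abelian.Ext.{u} X S.X₁ 1)) (f : X ⟶ S.X₃) :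
    ∃ g : X ⟶ S.X₂, g ≫ S.g = f := by
  obtain ⟨β, hβ⟩ := Abelian.Ext.covariant_sequence_exact₃ X hS (Abelian.Ext.mk₀ f)
    (n₁ := 1) rfl (Subsingleton.elim _ _)
  obtain ⟨g, rfl⟩ := (Abelian.Ext.mk₀_bijective _ _).2 β
  rw [Abelian.Ext.mk₀_comp_mk₀] at hβ
  exact ⟨g, (Abelian.Ext.mk₀_bijective _ _).1 hβ⟩

end Ext

/-! ### Character modules detect exactness -/

section Dual

variable {A B D : Type*} [AddCommGroup A] [AddCommGroup B] [AddCommGroup D]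
  [Module R A] [Module R B] [Module R D]

/-- ℚ/ℤ is an injective cogenerator: a point outside the range of `f` is separated from it by a
character, and a character killing ker `g` descends to the range of `g` and extends to `D`. -/
theorem exact_dual_iff (f : A →ₗ[R] B) (g : B →ₗ[R] D) :
    Function.Exact (CharacterModule.dual g) (CharacterModule.dual f) ↔ Function.Exact f g := by
  constructor
  · intro h b
    constructor
    · intro hb
      by_contra hn
      have hne : (LinearMap.range f).mkQ b ≠ 0 := by
        simpa [Submodule.Quotient.mk_eq_zero] using hn
      obtain ⟨c, hc⟩ := CharacterModule.exists_character_apply_ne_zero_of_ne_zero hne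
      have h1 : CharacterModule.dual f (CharacterModule.dual (LinearMap.range f).mkQ c) = 0 := by
        ext a
        have : (LinearMap.range f).mkQ (f a) = 0 := by simp
        change c ((LinearMap.range f).mkQ (f a)) = 0
        rw [this, map_zero]
      obtain ⟨ψ, hψ⟩ := (h _).1 h1
      apply hc
      have := DFunLike.congr_fun hψ b
      change ψ (g b) = c ((LinearMap.range f).mkQ b) at this
      rw [← this, hb, map_zero]
    · rintro ⟨a, rfl⟩
      refine CharacterModule.eq_zero_of_character_apply fun c => ?_
      exact DFunLike.congr_fun ((h _).2 ⟨c, rfl⟩) a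
  · intro h c
    constructor
    · intro hc
      have hle : LinearMap.ker g.rangeRestrict ≤ LinearMap.range f := by
        intro x hx
        exact (h x).1 (by simpa using hx)
      have hk : (LinearMap.ker g.rangeRestrict).toAddSubgroup ≤ AddMonoidHom.ker c := by
        intro x hx
        obtain ⟨a, rfl⟩ := hle hx
        exact DFunLike.congr_fun hc a
      let c' : CharacterModule (LinearMap.range g) :=
        (AddMonoidHom.liftOfSurjective (f := g.rangeRestrict.toAddMonoidHom)
          (hf := g.surjective_rangeRestrict)) ⟨c, hk⟩
      have hc' : ∀ b, c' (g.rangeRestrict b) = c b := fun b =>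
        AddMonoidHom.liftOfRightInverse_comp_apply g.rangeRestrict.toAddMonoidHom _
          (Function.rightInverse_surjInv g.surjective_rangeRestrict) ⟨c, hk⟩ b
      obtain ⟨ψ, hψ⟩ := CharacterModule.dual_surjective_of_injective (LinearMap.range g).subtype
        Subtype.val_injective c'
      refine ⟨ψ, ?_⟩
      ext b
      rw [← hc', ← hψ]
      rfl
    · rintro ⟨ψ, rfl⟩
      ext a
      change ψ (g (f a)) = 0
      rw [h.apply_apply_eq_zero, map_zero]

end Dual

/-! ### Tor-vanishing through Ext into the character module -/

section Tor

variable {C M : ModuleCat.{u} R}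

theorem isZero_tor_succ_iff (P : ProjectiveResolution M) (i : ℕ) :
    Limits.IsZero (((Tor (ModuleCat.{u} R) (i + 1)).obj C).obj M) ↔
      Function.Exact ((P.complex.d (i + 2) (i + 1)).hom.lTensor C)
        ((P.complex.d (i + 1) i).hom.lTensor C) := by
  refine (P.isoLeftDerivedObj (MonoidalCategory.tensorLeft C) (i + 1)).isZero_iff.trans ?_
  refine (HomologicalComplex.exactAt_iff_isZero_homology _ (i + 1)).symm.trans ?_
  rw [HomologicalComplex.exactAt_iff' _ (i + 2) (i + 1) i (by simp) (by simp),
    ShortComplex.ShortExact.moduleCat_exact_iff_function_exact]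
  rfl

/-- The characters of P ⊗ C are Hom(P, C⁺), C⁺ being the character module, so dualizing the complex
that computes Tor gives the one that computes Ext. The Ext sequences then serve for Tor as well. -/
theorem isZero_tor_succ_iff_ext (i : ℕ) :
    Limits.IsZero (((Tor (ModuleCat.{u} R) (i + 1)).obj C).obj M) ↔
      Subsingleton (Abelian.Ext.{u} M (ModuleCat.of R (CharacterModule C)) (i + 1)) := by
  have P := projectiveResolution M
  rw [isZero_tor_succ_iff P, subsingleton_ext_succ_iff P,
    ← LinearMap.rTensor_exact_iff_lTensor_exact, ← exact_dual_iff]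
  constructor
  · intro h f hf
    have h1 : CharacterModule.dual ((P.complex.d (i + 2) (i + 1)).hom.rTensor C)
        (CharacterModule.homEquiv f.hom) = 0 := by
      apply CharacterModule.homEquiv.symm.injective
      rw [map_zero]
      exact congrArg ModuleCat.Hom.hom hf
    obtain ⟨ψ, hψ⟩ := (h _).1 h1
    refine ⟨ModuleCat.ofHom (CharacterModule.homEquiv.symm ψ), ?_⟩
    ext1
    apply CharacterModule.homEquiv.injective
    rw [← hψ]
    apply CharacterModule.homEquiv.symm.injective
    rw [LinearEquiv.symm_apply_apply]
    rfl
  · intro h c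
    constructor
    · intro hc
      obtain ⟨g, hg⟩ := h (ModuleCat.ofHom (CharacterModule.homEquiv.symm c)) (by
        ext1
        exact (congrArg CharacterModule.homEquiv.symm hc).trans (map_zero _))
      refine ⟨CharacterModule.homEquiv g.hom, ?_⟩
      apply CharacterModule.homEquiv.symm.injective
      exact congrArg ModuleCat.Hom.hom hg
    · rintro ⟨ψ, rfl⟩
      rw [← LinearMap.comp_apply, ← CharacterModule.dual_comp, ← LinearMap.rTensor_comp,
        ← ModuleCat.hom_comp, P.complex.d_comp_d]
      simp [CharacterModule.dual_zero]

theorem torVanish_iff_extVanish :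
    TorVanish C M ↔ ExtVanish M (ModuleCat.of R (CharacterModule C)) := by
  constructor
  · rw [extVanish_iff_succ]
    exact fun h i => (isZero_tor_succ_iff_ext i).1 (h (i + 1) (by lia))
  · intro h i hi
    obtain ⟨j, rfl⟩ := Nat.exists_eq_add_of_le' hi
    exact (isZero_tor_succ_iff_ext j).2 (h _ hi)

theorem TorVanish.of_iso {M' : ModuleCat.{u} R} (e : M ≅ M') (h : TorVanish C M) :
    TorVanish C M' :=
  fun i hi => (h i hi).of_iso (((Tor (ModuleCat.{u} R) i).obj C).mapIso e.symm)

theorem lTensor_injective_iff_extension {A B : ModuleCat.{u} R} (f : A ⟶ B) :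
    Function.Injective (f.hom.lTensor C) ↔
      ∀ g : A ⟶ ModuleCat.of R (CharacterModule C),
        ∃ h : B ⟶ ModuleCat.of R (CharacterModule C), f ≫ h = g := by
  rw [LinearMap.lTensor_inj_iff_rTensor_inj, rTensor_injective_iff_lcomp_surjective]
  constructor
  · intro h g
    obtain ⟨k, hk⟩ := h g.hom
    exact ⟨ModuleCat.ofHom k, ModuleCat.hom_ext hk⟩
  · intro h g
    obtain ⟨k, hk⟩ := h (ModuleCat.ofHom g)
    exact ⟨k.hom, congrArg ModuleCat.Hom.hom hk⟩

variable {S : ShortComplex (ModuleCat.{u} R)} (hS : S.ShortExact)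

include hS

theorem lTensor_injective_of_torVanish (h₃ : TorVanish C S.X₃) :
    Function.Injective (S.f.hom.lTensor C) :=
  (lTensor_injective_iff_extension S.f).2 fun g =>
    exists_extension_of_subsingleton_ext hS (torVanish_iff_extVanish.1 h₃ 1 le_rfl) g

theorem TorVanish.X₁ (h₂ : TorVanish C S.X₂) (h₃ : TorVanish C S.X₃) : TorVanish C S.X₁ := by
  rw [torVanish_iff_extVanish] at *
  exact fun i hi => subsingleton_ext_left_X₁ hS i (h₂ i hi) (h₃ _ (by lia))

theorem isZero_tor_one_X₃ (h₂ : TorVanish C S.X₂)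
    (hinj : Function.Injective (S.f.hom.lTensor C)) :
    Limits.IsZero (((Tor (ModuleCat.{u} R) 1).obj C).obj S.X₃) :=
  (isZero_tor_succ_iff_ext 0).2 (subsingleton_ext_one_left_X₃ hS
    ((lTensor_injective_iff_extension S.f).1 hinj) (torVanish_iff_extVanish.1 h₂ 1 le_rfl))

theorem isZero_tor_succ_X₃ (h₂ : TorVanish C S.X₂) (i : ℕ)
    (h₁ : Limits.IsZero (((Tor (ModuleCat.{u} R) (i + 1)).obj C).obj S.X₁)) :
    Limits.IsZero (((Tor (ModuleCat.{u} R) (i + 2)).obj C).obj S.X₃) :=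
  (isZero_tor_succ_iff_ext (i + 1)).2 (subsingleton_ext_left_X₃ hS (i + 1)
    ((isZero_tor_succ_iff_ext i).1 h₁) (torVanish_iff_extVanish.1 h₂ _ (by lia)))

theorem TorVanish.X₃ (h₁ : TorVanish C S.X₁) (h₂ : TorVanish C S.X₂)
    (hinj : Function.Injective (S.f.hom.lTensor C)) : TorVanish C S.X₃ := by
  intro i hi
  obtain ⟨j, rfl⟩ := Nat.exists_eq_add_of_le' hi
  cases j with
  | zero => exact isZero_tor_one_X₃ hS h₂ hinj
  | succ j => exact isZero_tor_succ_X₃ hS h₂ j (h₁ _ (by lia))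

omit hS in
-- Flatness of `D` keeps A ⊗ N → B ⊗ N injective; followed by the injection B ⊗ N → B ⊗ N' it
-- factors through A ⊗ N → A ⊗ N'.
theorem flat_of_shortExact {A B D : Type u} [AddCommGroup A] [AddCommGroup B] [AddCommGroup D]
    [Module R A] [Module R B] [Module R D] [Module.Flat R B] [Module.Flat R D]
    (f : A →ₗ[R] B) (g : B →ₗ[R] D) (hf : Function.Injective f) (hg : Function.Surjective g)
    (h : Function.Exact f g) : Module.Flat R A := by
  rw [Module.Flat.iff_lTensor_preserves_injective_linearMap]
  intro N N' _ _ _ _ φ hφ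
  have h1 : Function.Injective (f.rTensor N) := by
    rw [← LinearMap.lTensor_inj_iff_rTensor_inj]
    exact LinearMap.lTensor_injective_of_exact_of_flat g hg f hf h N
  have h2 : Function.Injective (φ.lTensor B) :=
    Module.Flat.lTensor_preserves_injective_linearMap φ hφ
  have h3 : (f.rTensor N').comp (φ.lTensor A) = (φ.lTensor B).comp (f.rTensor N) := by
    rw [LinearMap.rTensor_comp_lTensor, LinearMap.lTensor_comp_rTensor]
  have h4 : Function.Injective ((f.rTensor N').comp (φ.lTensor A)) := by
    rw [h3]
    exact h2.comp h1
  exact Function.Injective.of_comp h4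

omit hS in
-- Tor is derived here in the variable `F`, so flatness enters by dimension shifting: the kernel of
-- a projective cover of `F` by a surjection is again flat.
theorem torVanish_of_flat (C F : ModuleCat.{u} R) [hF : Module.Flat R F] : TorVanish C F := by
  suffices H : ∀ (i : ℕ) (F : ModuleCat.{u} R), Module.Flat R F →
      Limits.IsZero (((Tor (ModuleCat.{u} R) (i + 1)).obj C).obj F) by
    intro i hi
    obtain ⟨j, rfl⟩ := Nat.exists_eq_add_of_le' hi
    exact H j F hF
  intro i
  induction i with
  | zero =>
    intro F hF
    let p : Projective.over F ⟶ F := Projective.π F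
    have hp : Function.Surjective p.hom := (ModuleCat.epi_iff_surjective p).1 inferInstance
    have hS := LinearMap.shortExact_shortComplexKer hp
    refine isZero_tor_one_X₃ hS (fun i hi => ?_) ?_
    · obtain ⟨j, rfl⟩ := Nat.exists_eq_add_of_le' hi
      exact isZero_Tor_succ_of_projective _ C (Projective.over F) j
    · exact LinearMap.lTensor_injective_of_exact_of_flat p.hom hp _ Subtype.val_injective
        (LinearMap.exact_subtype_ker_map _) C
  | succ i ih =>
    intro F hF
    let p : Projective.over F ⟶ F := Projective.π F
    have hp : Function.Surjective p.hom := (ModuleCat.epi_iff_surjective p).1 inferInstance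
    have hS := LinearMap.shortExact_shortComplexKer hp
    have hP : Module.Projective R (Projective.over (C := ModuleCat.{u} R) F) :=
      (IsProjective.iff_projective _).2 (Projective.projective_over F)
    refine isZero_tor_succ_X₃ hS (fun i hi => ?_) i (ih _ ?_)
    · obtain ⟨j, rfl⟩ := Nat.exists_eq_add_of_le' hi
      exact isZero_Tor_succ_of_projective _ C (Projective.over F) j
    · exact flat_of_shortExact (LinearMap.ker p.hom).subtype p.hom Subtype.val_injective hp
        (LinearMap.exact_subtype_ker_map _)

end Tor

end Foxby

namespace Foxby

variable {R : Type u} [CommRing R]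

/-! ### Unit and counit of the adjunction; faithful finitely generated modules -/

section Unbundled

variable (R) (C : Type u) [AddCommGroup C] [Module R C]

/-- The unit `M → Hom_R(C, C ⊗_R M)` of the tensor-hom adjunction. -/
noncomputable abbrev tensorUnit (M : Type u) [AddCommGroup M] [Module R M] :
    M →ₗ[R] C →ₗ[R] C ⊗[R] M :=
  (TensorProduct.mk R C M).flip

/-- The counit `C ⊗_R Hom_R(C, N) → N` of the tensor-hom adjunction. -/
noncomputable abbrev tensorCounit (N : Type u) [AddCommGroup N] [Module R N] :
    C ⊗[R] (C →ₗ[R] N) →ₗ[R] N :=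
  TensorProduct.lift LinearMap.applyₗ

variable {R C} {M M' N N' : Type u} [AddCommGroup M] [Module R M] [AddCommGroup M'] [Module R M']
  [AddCommGroup N] [Module R N] [AddCommGroup N'] [Module R N']

theorem tensorUnit_naturality (f : M →ₗ[R] M') (m : M) :
    tensorUnit R C M' (f m) = (f.lTensor C).comp (tensorUnit R C M m) := by
  ext c
  simp

theorem tensorCounit_naturality (f : N →ₗ[R] N') (z : C ⊗[R] (C →ₗ[R] N)) :
    tensorCounit R C N' ((f.compRight R : (C →ₗ[R] N) →ₗ[R] C →ₗ[R] N').lTensor C z) =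
      f (tensorCounit R C N z) := by
  induction z with
  | zero => simp
  | add x y hx hy => simp only [map_add, hx, hy]
  | tmul c g => simp

theorem tensorCounit_comp_tensorUnit (g : C →ₗ[R] N) :
    (tensorCounit R C N).comp (tensorUnit R C (C →ₗ[R] N) g) = g := by
  ext c
  simp

/-- By a triangle identity, composition with the counit is a left inverse of the unit, and it is
also a right inverse once the counit is injective. -/
theorem tensorUnit_bijective_of_tensorCounit (h : Function.Bijective (tensorCounit R C N)) :
    Function.Bijective (tensorUnit R C (C →ₗ[R] N)) := by
  constructor
  · intro f g hfg
    rw [← tensorCounit_comp_tensorUnit f, ← tensorCounit_comp_tensorUnit g, hfg]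
  · intro k
    refine ⟨(tensorCounit R C N).comp k, ?_⟩
    ext c
    apply h.1
    exact LinearMap.congr_fun (tensorCounit_comp_tensorUnit ((tensorCounit R C N).comp k)) c

theorem tensorCounit_bijective_of_tensorUnit (h : Function.Bijective (tensorUnit R C M)) :
    Function.Bijective (tensorCounit R C (C ⊗[R] M)) := by
  have h1 : (tensorCounit R C (C ⊗[R] M)).comp ((tensorUnit R C M).lTensor C) = LinearMap.id := by
    ext
    simp
  have h2 : Function.Bijective ((tensorUnit R C M).lTensor C) :=
    (LinearEquiv.lTensor C (LinearEquiv.ofBijective _ h)).bijective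
  have h3 : Function.Bijective ((tensorCounit R C (C ⊗[R] M)) ∘ ((tensorUnit R C M).lTensor C)) := by
    rw [← LinearMap.coe_comp, h1]
    exact Function.bijective_id
  exact (Function.Bijective.of_comp_iff _ h2).1 h3

theorem tensorUnit_bijective_congr (e : M ≃ₗ[R] M') (h : Function.Bijective (tensorUnit R C M)) :
    Function.Bijective (tensorUnit R C M') := by
  have h1 : (tensorUnit R C M' : M' → C →ₗ[R] C ⊗[R] M') =
      (LinearEquiv.congrRight (LinearEquiv.lTensor C e)) ∘ (tensorUnit R C M) ∘ e.symm := by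
    funext m
    ext c
    change c ⊗ₜ[R] m = c ⊗ₜ[R] e (e.symm m)
    simp
  rw [h1]
  exact (LinearEquiv.bijective _).comp (h.comp e.symm.bijective)

theorem tensorCounit_bijective_congr (e : N ≃ₗ[R] N')
    (h : Function.Bijective (tensorCounit R C N)) : Function.Bijective (tensorCounit R C N') := by
  have h1 : (tensorCounit R C N' : C ⊗[R] (C →ₗ[R] N') → N') =
      e ∘ (tensorCounit R C N) ∘ (LinearEquiv.lTensor C (LinearEquiv.congrRight e.symm)) := by
    funext z
    induction z with
    | zero => simp
    | add x y hx hy => simpa using congrArg₂ (· + ·) hx hy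
    | tmul c g =>
      change g c = e (e.symm (g c))
      simp
  rw [h1]
  exact e.bijective.comp (h.comp (LinearEquiv.bijective _))

/-- A nonzero module receives a nonzero map from every finitely generated faithful module. -/
theorem subsingleton_of_subsingleton_hom (n : ℕ) :
    ∀ (C K : Type u) [AddCommGroup C] [Module R C] [AddCommGroup K] [Module R K]
      (c : Fin n → C), Submodule.span R (Set.range c) = ⊤ →
      (∀ a ∈ Module.annihilator R C, ∀ y : K, a • y = 0) →
      (∀ f : C →ₗ[R] K, f = 0) → ∀ y : K, y = 0 := by
  induction n with
  | zero =>
    intro C K _ _ _ _ c hc hann _ y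
    have : Subsingleton C := by
      rw [← Submodule.subsingleton_iff R, ← subsingleton_iff_bot_eq_top, ← hc]
      simp
    have h1 : (1 : R) ∈ Module.annihilator R C :=
      Module.mem_annihilator.2 fun m => Subsingleton.elim _ _
    simpa using hann 1 h1 y
  | succ n ih =>
    intro C K _ _ _ _ c hc hann hhom
    -- Induction along 0 → L → C → C/L → 0: ann(L) · ann(C/L) lies in ann(C), hence kills `K`, so it
    -- suffices that no nonzero element of `K` is killed by either factor.
    let L : Submodule R C := R ∙ (c 0)
    -- elements killed by the annihilator of `C ⧸ L` vanish
    have key1 : ∀ y : K, (∀ a ∈ Module.annihilator R (C ⧸ L), a • y = 0) → y = 0 := by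
      intro y hy
      let K' : Submodule R K := R ∙ y
      have h := ih (C ⧸ L) K' (fun i => L.mkQ (c i.succ)) ?_ ?_ ?_
        ⟨y, Submodule.mem_span_singleton_self y⟩
      · exact congrArg Subtype.val h
      · have h2 : (Submodule.span R (Set.range c)).map L.mkQ = ⊤ := by
          rw [hc, Submodule.map_top, Submodule.range_mkQ]
        rw [Submodule.map_span, ← Set.range_comp] at h2
        rw [eq_top_iff, ← h2, Submodule.span_le]
        rintro _ ⟨i, rfl⟩
        refine Fin.cases ?_ (fun j => ?_) i
        · have : L.mkQ (c 0) = 0 := by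
            simp [L]
          simp only [Function.comp_apply, this]
          exact Submodule.zero_mem _
        · exact Submodule.subset_span ⟨j, rfl⟩
      · rintro a ha ⟨z, hz⟩
        obtain ⟨r, rfl⟩ := Submodule.mem_span_singleton.1 hz
        ext
        simp [smul_comm a r, hy a ha]
      · intro f
        ext x
        exact LinearMap.congr_fun (hhom (K'.subtype.comp (f.comp L.mkQ))) x
    -- elements killed by the annihilator of `c 0` vanish
    have key2 : ∀ y : K, (∀ b : R, b • c 0 = 0 → b • y = 0) → y = 0 := by
      intro y hy
      refine key1 y fun a ha => ?_
      have ha' : ∀ x : C, a • x ∈ L := fun x => by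
        have := Module.mem_annihilator.1 ha (L.mkQ x)
        rwa [← map_smul, Submodule.mkQ_apply, Submodule.Quotient.mk_eq_zero] at this
      -- Multiplication by `a` maps `C` into `L`, and c₀ ↦ y is well defined on `L`; the composite C
      -- → K vanishes and sends c₀ to a • y.
      let m : C →ₗ[R] L := (LinearMap.lsmul R C a).codRestrict L ha'
      let e : (R ⧸ LinearMap.ker (LinearMap.toSpanSingleton R C (c 0))) ≃ₗ[R]
        LinearMap.range (LinearMap.toSpanSingleton R C (c 0)) :=
          LinearMap.quotKerEquivRange _
      have hL : L = LinearMap.range (LinearMap.toSpanSingleton R C (c 0)) :=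
        (LinearMap.range_toSpanSingleton (c 0)).symm
      let t : (R ⧸ LinearMap.ker (LinearMap.toSpanSingleton R C (c 0))) →ₗ[R] K :=
        Submodule.liftQ _ (LinearMap.toSpanSingleton R K y) fun b hb => by
          simpa using hy b (by simpa using hb)
      let f : C →ₗ[R] K := t.comp (e.symm.toLinearMap.comp
        ((LinearEquiv.ofEq _ _ hL).toLinearMap.comp m))
      have h1 := LinearMap.congr_fun (hhom f) (c 0)
      have h2 : e.symm (LinearEquiv.ofEq _ _ hL (m (c 0))) = Submodule.Quotient.mk a := by
        rw [LinearEquiv.symm_apply_eq]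
        rfl
      simp only [f, LinearMap.comp_apply, LinearEquiv.coe_coe, h2] at h1
      exact h1
    intro y
    refine key1 y fun a ha => key2 _ fun b hb => ?_
    rw [← mul_smul]
    refine hann _ (Module.mem_annihilator.2 fun x => ?_) y
    have hx := Module.mem_annihilator.1 ha (L.mkQ x)
    rw [← map_smul, Submodule.mkQ_apply, Submodule.Quotient.mk_eq_zero] at hx
    obtain ⟨r, hr⟩ := Submodule.mem_span_singleton.1 hx
    rw [mul_smul, ← hr, smul_comm, hb, smul_zero]

theorem subsingleton_of_hom_eq_zero (K : Type u) [AddCommGroup K] [Module R K]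
    [Module.Finite R C] (hC : Function.Injective (LinearMap.lsmul R C : R →ₗ[R] C →ₗ[R] C))
    (h : ∀ f : C →ₗ[R] K, f = 0) (y : K) : y = 0 := by
  obtain ⟨n, c, hc⟩ := Module.Finite.exists_fin (R := R) (M := C)
  refine subsingleton_of_subsingleton_hom n C K c hc (fun a ha z => ?_) h y
  have : a = 0 := hC (by
    ext x
    simpa using Module.mem_annihilator.1 ha x)
  simp [this]

end Unbundled

/-! ### Flat and injective modules via a finite presentation of C -/

section Presentation

variable {C P Q F I : Type u} [AddCommGroup C] [Module R C] [AddCommGroup P] [Module R P]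
  [AddCommGroup Q] [Module R Q] [AddCommGroup F] [Module R F] [AddCommGroup I] [Module R I]
  [Module.Finite R P] [Module.Projective R P] [Module.Finite R Q] [Module.Projective R Q]
  (d : Q →ₗ[R] P) (p : P →ₗ[R] C)

omit [Module.Finite R P] [Module.Projective R P] [Module.Finite R Q] [Module.Projective R Q] in
theorem homothety_exact (hp : Function.Surjective p) (hdp : Function.Exact d p)
    (hC : Function.Bijective (LinearMap.lsmul R C : R →ₗ[R] C →ₗ[R] C)) :
    Function.Injective (LinearMap.toSpanSingleton R (P →ₗ[R] C) p) ∧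
      Function.Exact (LinearMap.toSpanSingleton R (P →ₗ[R] C) p) (LinearMap.lcomp R C d) := by
  have h := LinearMap.exact_lcomp_of_exact_of_surjective C hdp hp
  constructor
  · intro r s hrs
    apply hC.1
    ext c
    obtain ⟨x, rfl⟩ := hp c
    exact LinearMap.congr_fun hrs x
  · intro f
    rw [h f]
    constructor
    · rintro ⟨g, rfl⟩
      obtain ⟨r, rfl⟩ := hC.2 g
      exact ⟨r, by ext; simp⟩
    · rintro ⟨r, rfl⟩
      exact ⟨LinearMap.lsmul R C r, by ext; simp⟩

/-- Tensoring the sequence of `homothety_exact` with `F` and using F ⊗ Hom(P, C) ≅ Hom(P, F ⊗ C) for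
finite projective P identifies F with the kernel Hom(C, F ⊗ C). -/
theorem tensorUnit_bijective_of_flat [Module.Flat R F] (hp : Function.Surjective p)
    (hdp : Function.Exact d p)
    (hC : Function.Bijective (LinearMap.lsmul R C : R →ₗ[R] C →ₗ[R] C)) :
    Function.Bijective (tensorUnit R C F) := by
  obtain ⟨hinj, hex⟩ := homothety_exact d p hp hdp hC
  have hinj' := Module.Flat.lTensor_preserves_injective_linearMap (M := F) _ hinj
  have hex' := Module.Flat.lTensor_exact F hex
  have key : ∀ (x : F) (a : P), lTensorHomEquivHomLTensor R P F C
      ((LinearMap.toSpanSingleton R (P →ₗ[R] C) p).lTensor F (x ⊗ₜ 1)) a = x ⊗ₜ p a := by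
    intro x a
    simp
  constructor
  · rw [injective_iff_map_eq_zero]
    intro x hx
    have h1 : (LinearMap.toSpanSingleton R (P →ₗ[R] C) p).lTensor F (x ⊗ₜ 1) = 0 := by
      apply (lTensorHomEquivHomLTensor R P F C).injective
      rw [map_zero]
      ext a
      rw [key]
      have := congrArg (TensorProduct.comm R C F) (LinearMap.congr_fun hx (p a))
      simpa using this
    have h2 := hinj' (h1.trans (map_zero _).symm)
    simpa using congrArg (TensorProduct.rid R F) h2
  · intro g
    obtain ⟨t, ht⟩ := (lTensorHomEquivHomLTensor R P F C).surjective
      ((TensorProduct.comm R C F).toLinearMap.comp (g.comp p))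
    have h1 : (LinearMap.lcomp R C d).lTensor F t = 0 := by
      apply (lTensorHomEquivHomLTensor R Q F C).injective
      have h2 : lTensorHomEquivHomLTensor R Q F C ((LinearMap.lcomp R C d).lTensor F t) =
          (lTensorHomEquivHomLTensor R P F C t).comp d := by
        clear ht
        induction t with
        | zero => simp
        | add x y hx hy => simp only [map_add, LinearMap.add_comp, hx, hy]
        | tmul x f => ext; simp
      rw [h2, ht, map_zero]
      ext a
      simp [hdp.apply_apply_eq_zero]
    obtain ⟨w, rfl⟩ := (hex' t).1 h1
    obtain ⟨x, rfl⟩ := (TensorProduct.rid R F).symm.surjective w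
    refine ⟨x, ?_⟩
    ext c
    obtain ⟨a, rfl⟩ := hp c
    apply (TensorProduct.comm R C F).injective
    have := LinearMap.congr_fun ht a
    rw [TensorProduct.rid_symm_apply, key] at this
    simpa using this

variable (C P I) in
/-- The evaluation map `P ⊗ Hom(C, I) → Hom(Hom(P, C), I)`. -/
noncomputable def homEvaluation : P ⊗[R] (C →ₗ[R] I) →ₗ[R] (P →ₗ[R] C) →ₗ[R] I :=
  TensorProduct.lift
    ((LinearMap.llcomp R (P →ₗ[R] C) C I).flip.comp LinearMap.applyₗ)

omit [Module.Finite R P] [Module.Projective R P] in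
@[simp]
theorem homEvaluation_tmul (a : P) (f : C →ₗ[R] I) (h : P →ₗ[R] C) :
    homEvaluation C P I (a ⊗ₜ f) h = f (h a) := rfl

/-- A finite dual basis of `P`, read off from a retraction of Rⁿ onto `P`, gives the inverse
explicitly. -/
theorem homEvaluation_bijective : Function.Bijective (homEvaluation (R := R) C P I) := by
  obtain ⟨n, f, g, -, -, hfg⟩ := Module.Finite.exists_comp_eq_id_of_projective R P
  have hsum : ∀ a : P, a = ∑ i, g a i • f (Pi.single i 1) := by
    intro a
    conv_lhs => rw [← LinearMap.id_apply (R := R) a, ← hfg, LinearMap.comp_apply,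
      pi_eq_sum_univ' (g a), map_sum]
    refine Finset.sum_congr rfl fun i _ => ?_
    rw [map_smul]
  let inv : ((P →ₗ[R] C) →ₗ[R] I) → P ⊗[R] (C →ₗ[R] I) := fun v =>
    ∑ i, f (Pi.single i 1) ⊗ₜ[R]
      (v.comp (LinearMap.smulRightₗ ((LinearMap.proj i).comp g)))
  refine Function.bijective_iff_has_inverse.2 ⟨inv, fun z => ?_, fun v => ?_⟩
  · have hadd : ∀ v w, inv (v + w) = inv v + inv w := by
      intro v w
      simp [inv, LinearMap.add_comp, TensorProduct.tmul_add, Finset.sum_add_distrib]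
    induction z with
    | zero => simp [inv]
    | add x y hx hy => rw [map_add, hadd, hx, hy]
    | tmul a k =>
      conv_rhs => rw [hsum a, TensorProduct.sum_tmul]
      refine Finset.sum_congr rfl fun i _ => ?_
      rw [TensorProduct.smul_tmul]
      congr 1
      ext c
      simp
  · ext h
    simp only [inv, map_sum, LinearMap.sum_apply, homEvaluation_tmul, LinearMap.comp_apply]
    rw [← map_sum]
    congr 1
    ext a
    conv_rhs => rw [hsum a]
    simp

/-- Hom(-, I) turns the sequence of `homothety_exact` into Q ⊗ Hom(C, I) → P ⊗ Hom(C, I) → I → 0, by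
`homEvaluation_bijective`; the cokernel of the first map is C ⊗ Hom(C, I). -/
theorem tensorCounit_bijective_of_injective [Module.Injective R I] (hp : Function.Surjective p)
    (hdp : Function.Exact d p)
    (hC : Function.Bijective (LinearMap.lsmul R C : R →ₗ[R] C →ₗ[R] C)) :
    Function.Bijective (tensorCounit R C I) := by
  obtain ⟨hinj, hex⟩ := homothety_exact d p hp hdp hC
  have hev : ∀ t : P ⊗[R] (C →ₗ[R] I),
      homEvaluation C P I t p = tensorCounit R C I (p.rTensor _ t) := by
    intro t
    induction t with
    | zero => simp
    | add x y hx hy => simp only [map_add, LinearMap.add_apply, hx, hy]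
    | tmul a f => simp
  have hnat : ∀ s : Q ⊗[R] (C →ₗ[R] I), homEvaluation C P I (d.rTensor _ s) =
      (homEvaluation C Q I s).comp (LinearMap.lcomp R C d) := by
    intro s
    induction s with
    | zero => simp
    | add x y hx hy => simp only [map_add, LinearMap.add_comp, hx, hy]
    | tmul a f => ext; simp
  constructor
  · rw [injective_iff_map_eq_zero]
    intro z hz
    obtain ⟨t, rfl⟩ := LinearMap.rTensor_surjective (C →ₗ[R] I) hp z
    rw [← hev] at hz
    -- the map attached to `t` factors through `Hom(d, C)`
    have hle : LinearMap.ker (LinearMap.lcomp R C d).rangeRestrict ≤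
        LinearMap.ker (homEvaluation C P I t) := by
      intro f hf
      obtain ⟨r, rfl⟩ := (hex f).1 (by simpa using hf)
      simp [hz]
    let e := (LinearMap.lcomp R C d).rangeRestrict.quotKerEquivOfSurjective
      (LinearMap.surjective_rangeRestrict _)
    let v₀ : LinearMap.range (LinearMap.lcomp R C d) →ₗ[R] I :=
      (Submodule.liftQ _ (homEvaluation C P I t) hle).comp e.symm.toLinearMap
    -- Injectivity of `I` extends the factorization to Hom(Q, C), where it comes from some `s`; then
    -- `t` is the image of `s` and dies in C ⊗ Hom(C, I).
    obtain ⟨v, hv⟩ := Module.Injective.out (LinearMap.range (LinearMap.lcomp R C d)).subtype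
      Subtype.val_injective v₀
    obtain ⟨s, rfl⟩ := homEvaluation_bijective.2 v
    have ht : t = d.rTensor _ s := by
      apply homEvaluation_bijective.1
      rw [hnat]
      ext f
      have h1 := hv ((LinearMap.lcomp R C d).rangeRestrict f)
      have h2 : e.symm ((LinearMap.lcomp R C d).rangeRestrict f) = Submodule.Quotient.mk f := by
        rw [LinearEquiv.symm_apply_eq]
        rfl
      simp only [v₀, LinearMap.comp_apply, LinearEquiv.coe_coe, h2] at h1
      exact h1.symm
    rw [ht, ← LinearMap.comp_apply, ← LinearMap.rTensor_comp, hdp.linearMap_comp_eq_zero]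
    simp
  · intro y
    obtain ⟨v, hv⟩ := Module.Injective.out (LinearMap.toSpanSingleton R (P →ₗ[R] C) p) hinj
      (LinearMap.toSpanSingleton R I y)
    obtain ⟨t, rfl⟩ := homEvaluation_bijective.2 v
    refine ⟨p.rTensor _ t, ?_⟩
    rw [← hev]
    simpa using hv 1

end Presentation

end Foxby

/-! ### Semidualizing modules and closure of the Auslander class -/

namespace Foxby

variable {R : Type u} [CommRing R] {C : ModuleCat.{u} R}

theorem IsSemidualizing.exists_presentation (hC : IsSemidualizing C) :
    ∃ (Q P : ModuleCat.{u} R) (d : Q →ₗ[R] P) (p : P →ₗ[R] C),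
      (Module.Finite R P ∧ Module.Projective R P) ∧
      (Module.Finite R Q ∧ Module.Projective R Q) ∧
      Function.Surjective p ∧ Function.Exact d p := by
  obtain ⟨P, hP⟩ := hC.resolution
  refine ⟨P.complex.X 1, P.complex.X 0, (P.complex.d 1 0).hom,
    (show P.complex.X 0 ⟶ C from P.π.f 0).hom,
    ⟨hP 0, (IsProjective.iff_projective _).2 (P.projective 0)⟩,
    ⟨hP 1, (IsProjective.iff_projective _).2 (P.projective 1)⟩, ?_, ?_⟩
  · exact (ModuleCat.epi_iff_surjective (P.π.f 0)).1 inferInstance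
  · exact (ShortComplex.ShortExact.moduleCat_exact_iff_function_exact _).1 P.exact₀

theorem IsSemidualizing.finite (hC : IsSemidualizing C) : Module.Finite R C := by
  obtain ⟨Q, P, d, p, ⟨h, -⟩, -, hp, -⟩ := hC.exists_presentation
  exact Module.Finite.of_surjective p hp

theorem IsSemidualizing.tensorUnit_bijective_of_flat (hC : IsSemidualizing C)
    (F : Type u) [AddCommGroup F] [Module R F] [Module.Flat R F] :
    Function.Bijective (tensorUnit R C F) := by
  obtain ⟨Q, P, d, p, ⟨_, _⟩, ⟨_, _⟩, hp, hdp⟩ := hC.exists_presentation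
  exact Foxby.tensorUnit_bijective_of_flat d p hp hdp hC.homothety

theorem IsSemidualizing.tensorCounit_bijective_of_injective (hC : IsSemidualizing C)
    (I : Type u) [AddCommGroup I] [Module R I] [Module.Injective R I] :
    Function.Bijective (tensorCounit R C I) := by
  obtain ⟨Q, P, d, p, ⟨_, _⟩, ⟨_, _⟩, hp, hdp⟩ := hC.exists_presentation
  exact Foxby.tensorCounit_bijective_of_injective d p hp hdp hC.homothety

/-- Hom(P, C) is exact in positive degrees for the finite projective resolution P; tensoring with
`F` preserves this and yields Hom(P, F ⊗ C). -/
theorem IsSemidualizing.extVanish_of_flat (hC : IsSemidualizing C)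
    (F : ModuleCat.{u} R) [Module.Flat R F] : ExtVanish C ((tensorFunctor C).obj F) := by
  obtain ⟨P, hP⟩ := hC.resolution
  have hproj : ∀ n, Module.Projective R (P.complex.X n) := fun n =>
    (IsProjective.iff_projective _).2 (P.projective n)
  refine ExtVanish.of_iso (Y := ModuleCat.of R (F ⊗[R] C))
    (TensorProduct.comm R F C).toModuleIso ?_
  rw [extVanish_iff_succ]
  intro i
  have hex : Function.Exact (LinearMap.lcomp R C (P.complex.d (i + 1) i).hom)
      (LinearMap.lcomp R C (P.complex.d (i + 2) (i + 1)).hom) := by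
    intro f
    constructor
    · intro hf
      obtain ⟨g, hg⟩ := (subsingleton_ext_succ_iff P i).1 (hC.ext_vanish (i + 1) (by lia))
        (ModuleCat.ofHom f) (ModuleCat.hom_ext hf)
      exact ⟨g.hom, congrArg ModuleCat.Hom.hom hg⟩
    · rintro ⟨g, rfl⟩
      exact congrArg ModuleCat.Hom.hom (P.complex.d_comp_d_assoc (i + 2) (i + 1) i
        (ModuleCat.ofHom g)) |>.trans (by simp)
  have hex' := Module.Flat.lTensor_exact F hex
  have hnat : ∀ (m n : ℕ) (t : F ⊗[R] (P.complex.X n →ₗ[R] C)),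
      lTensorHomEquivHomLTensor R (P.complex.X m) F C
        ((LinearMap.lcomp R C (P.complex.d m n).hom).lTensor F t) =
      (lTensorHomEquivHomLTensor R (P.complex.X n) F C t).comp (P.complex.d m n).hom := by
    intro m n t
    induction t with
    | zero => simp
    | add x y hx hy => simp only [map_add, LinearMap.add_comp, hx, hy]
    | tmul x f => ext; simp
  rw [subsingleton_ext_succ_iff P i]
  intro f hf
  obtain ⟨t, ht⟩ := (lTensorHomEquivHomLTensor R (P.complex.X (i + 1)) F C).surjective f.hom
  have h1 : (LinearMap.lcomp R C (P.complex.d (i + 2) (i + 1)).hom).lTensor F t = 0 := by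
    apply (lTensorHomEquivHomLTensor R (P.complex.X (i + 2)) F C).injective
    rw [hnat, ht, map_zero]
    exact congrArg ModuleCat.Hom.hom hf
  obtain ⟨s, rfl⟩ := (hex' t).1 h1
  refine ⟨ModuleCat.ofHom (lTensorHomEquivHomLTensor R (P.complex.X i) F C s), ?_⟩
  ext1
  rw [← ht, hnat]
  rfl

theorem auslanderClass.of_linearEquiv {M M' : ModuleCat.{u} R} (e : M ≃ₗ[R] M')
    (h : auslanderClass C M) : auslanderClass C M' :=
  ⟨h.1.of_iso e.toModuleIso, h.2.1.of_iso ((tensorFunctor C).mapIso e.toModuleIso),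
    tensorUnit_bijective_congr e h.2.2⟩

theorem IsSemidualizing.auslanderClass_of_flat (hC : IsSemidualizing C)
    (F : ModuleCat.{u} R) [Module.Flat R F] : auslanderClass C F :=
  ⟨torVanish_of_flat C F, hC.extVanish_of_flat F, hC.tensorUnit_bijective_of_flat F⟩

/-- A map from C into the kernel of C ⊗ f is the unit at some a ∈ A; naturality forces f(a) = 0, so
a = 0. Thus Hom(C, kernel) = 0, and C is finitely generated and faithful. -/
theorem IsSemidualizing.lTensor_injective (hC : IsSemidualizing C) {A B : Type u}
    [AddCommGroup A] [Module R A] [AddCommGroup B] [Module R B] (f : A →ₗ[R] B)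
    (hf : Function.Injective f) (hA : Function.Surjective (tensorUnit R C A))
    (hB : Function.Injective (tensorUnit R C B)) : Function.Injective (f.lTensor C) := by
  have := hC.finite
  rw [injective_iff_map_eq_zero]
  intro z hz
  have key := subsingleton_of_hom_eq_zero (R := R) (C := C) (LinearMap.ker (f.lTensor C))
    hC.homothety.1 ?_ ⟨z, hz⟩
  · exact congrArg Subtype.val key
  · intro g
    obtain ⟨a, ha⟩ := hA ((LinearMap.ker (f.lTensor C)).subtype.comp g)
    have h1 : tensorUnit R C B (f a) = 0 := by
      rw [tensorUnit_naturality, ha]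
      ext c
      exact (g c).2
    have h2 : a = 0 := hf ((hB (h1.trans (map_zero _).symm)).trans (map_zero f).symm)
    ext c
    have := LinearMap.congr_fun ha c
    rw [h2] at this
    simpa using this.symm

variable {S : ShortComplex (ModuleCat.{u} R)}

theorem tensor_shortExact (hS : S.ShortExact) (hinj : Function.Injective (S.f.hom.lTensor C)) :
    (S.map (tensorFunctor C)).ShortExact :=
  ModuleCat.shortComplex_shortExact _
    (lTensor_exact C ((ShortComplex.ShortExact.moduleCat_exact_iff_function_exact S).1 hS.exact)
      hS.moduleCat_surjective_g) hinj (LinearMap.lTensor_surjective C hS.moduleCat_surjective_g)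

/-- Once C ⊗ S is known to be short exact, the long exact sequences give the vanishing. Since
Ext¹(C, C ⊗ X₁) = 0, Hom(C, C ⊗ S) is exact too, and the unit at X₃ follows by a chase. -/
theorem IsSemidualizing.auslanderClass_X₃ (hC : IsSemidualizing C) (hS : S.ShortExact)
    (h₁ : auslanderClass C S.X₁) (h₂ : auslanderClass C S.X₂) : auslanderClass C S.X₃ := by
  have hf : Function.Injective S.f.hom := hS.moduleCat_injective_f
  have hg : Function.Surjective S.g.hom := hS.moduleCat_surjective_g
  have hfg : Function.Exact S.f.hom S.g.hom :=
    (ShortComplex.ShortExact.moduleCat_exact_iff_function_exact S).1 hS.exact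
  have hinj := hC.lTensor_injective S.f.hom hf h₁.2.2.2 h₂.2.2.1
  have hT := tensor_shortExact hS hinj
  have hex : Function.Exact (S.f.hom.lTensor C) (S.g.hom.lTensor C) := lTensor_exact C hfg hg
  refine ⟨TorVanish.X₃ hS h₁.1 h₂.1 hinj, fun i hi => ?_, ?_, fun k => ?_⟩
  · exact subsingleton_ext_right_X₃ hT i (h₁.2.1 _ (by lia)) (h₂.2.1 i hi)
  · refine (injective_iff_map_eq_zero (tensorUnit R C S.X₃)).2 fun y hy => ?_
    obtain ⟨x, rfl⟩ := hg y
    have h3 : ∀ c, tensorUnit R C S.X₂ x c ∈ LinearMap.range (S.f.hom.lTensor C) := fun c =>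
      (hex _).1 (by
        have := LinearMap.congr_fun hy c
        rwa [tensorUnit_naturality] at this)
    let e := LinearEquiv.ofInjective _ hinj
    obtain ⟨m, hm⟩ := h₁.2.2.2 (e.symm.toLinearMap.comp
      ((tensorUnit R C S.X₂ x).codRestrict _ h3))
    have h4 : tensorUnit R C S.X₂ (S.f.hom m) = tensorUnit R C S.X₂ x := by
      rw [tensorUnit_naturality]
      ext c
      have h5 := LinearMap.congr_fun hm c
      have h6 := congrArg e h5
      rw [LinearMap.comp_apply, LinearEquiv.coe_coe, LinearEquiv.apply_symm_apply] at h6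
      exact congrArg Subtype.val h6
    rw [← h₂.2.2.1 h4]
    exact hfg.apply_apply_eq_zero m
  · obtain ⟨l, hl⟩ := exists_lift_of_subsingleton_ext hT (h₁.2.1 1 le_rfl)
      (ModuleCat.ofHom k : C ⟶ (tensorFunctor C).obj S.X₃)
    obtain ⟨x, hx⟩ := h₂.2.2.2 l.hom
    refine ⟨S.g.hom x, ?_⟩
    refine (tensorUnit_naturality S.g.hom x).trans ?_
    have h7 : tensorUnit R C S.X₂ x = l.hom := hx
    rw [h7]
    exact congrArg ModuleCat.Hom.hom hl

/-! ### Acyclic complexes and their cycles -/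

section Complex

variable {K : CochainComplex (ModuleCat.{u} R) ℤ}

theorem acyclic_iff_exact : K.Acyclic ↔
    ∀ n : ℤ, Function.Exact (K.d n (n + 1)).hom (K.d (n + 1) (n + 1 + 1)).hom := by
  have h : ∀ n : ℤ, K.ExactAt (n + 1) ↔
      Function.Exact (K.d n (n + 1)).hom (K.d (n + 1) (n + 1 + 1)).hom := fun n => by
    rw [HomologicalComplex.exactAt_iff' K n (n + 1) (n + 1 + 1) (by simp) (by simp),
      ShortComplex.ShortExact.moduleCat_exact_iff_function_exact]
    rfl
  simp only [← h]
  exact ⟨fun H n => H _, fun H n => by simpa using H (n - 1)⟩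

theorem exactAfter_tensorFunctor_iff {X : ModuleCat.{u} R} : ExactAfter (tensorFunctor X) K ↔
    ∀ n : ℤ, Function.Exact ((K.d n (n + 1)).hom.lTensor X)
      ((K.d (n + 1) (n + 1 + 1)).hom.lTensor X) :=
  acyclic_iff_exact

theorem exactAfter_homFunctor_iff {X : ModuleCat.{u} R} : ExactAfter (homFunctor X) K ↔
    ∀ (n : ℤ) (f : X →ₗ[R] K.X (n + 1)), (K.d (n + 1) (n + 1 + 1)).hom.comp f = 0 →
      ∃ g : X →ₗ[R] K.X n, (K.d n (n + 1)).hom.comp g = f := by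
  refine acyclic_iff_exact.trans (forall_congr' fun n => ?_)
  constructor
  · intro h f hf
    obtain ⟨g, hg⟩ := (h (ModuleCat.ofHom f)).1 (ModuleCat.hom_ext hf)
    exact ⟨g.hom, congrArg ModuleCat.Hom.hom hg⟩
  · intro h f
    constructor
    · intro hf
      obtain ⟨g, hg⟩ := h f.hom (congrArg ModuleCat.Hom.hom hf)
      exact ⟨ModuleCat.ofHom g, ModuleCat.hom_ext hg⟩
    · rintro ⟨g, rfl⟩
      have hzero : ∀ g : X ⟶ K.X n, (g ≫ K.d n (n + 1)) ≫ K.d (n + 1) (n + 1 + 1) = 0 := by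
        simp
      exact hzero g

variable (K) in
/-- The module of cycles of a complex in degree `n`. -/
abbrev cyclesModule (n : ℤ) : ModuleCat.{u} R :=
  ModuleCat.of R (LinearMap.ker (K.d n (n + 1)).hom)

variable (K) in
/-- The differential, corestricted to the cycles of its target. -/
def toCyclesModule (n : ℤ) : K.X n →ₗ[R] LinearMap.ker (K.d (n + 1) (n + 1 + 1)).hom :=
  (K.d n (n + 1)).hom.codRestrict _ fun x => LinearMap.mem_ker.2
    (LinearMap.congr_fun (congrArg ModuleCat.Hom.hom (K.d_comp_d n (n + 1) (n + 1 + 1))) x)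

variable (K) in
/-- The sequence `0 → Zⁿ → Kⁿ → Zⁿ⁺¹ → 0`. -/
abbrev cyclesSequence (n : ℤ) : ShortComplex (ModuleCat.{u} R) where
  X₁ := cyclesModule K n
  X₂ := K.X n
  X₃ := cyclesModule K (n + 1)
  f := ModuleCat.ofHom (LinearMap.ker (K.d n (n + 1)).hom).subtype
  g := ModuleCat.ofHom (toCyclesModule K n)
  zero := by
    ext x
    exact congrArg Subtype.val (Subtype.ext x.2 : toCyclesModule K n x.1 = 0)

theorem toCyclesModule_surjective (hK : K.Acyclic) (n : ℤ) :
    Function.Surjective (toCyclesModule K n) := by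
  rintro ⟨z, hz⟩
  obtain ⟨x, rfl⟩ := (acyclic_iff_exact.1 hK n z).1 hz
  exact ⟨x, rfl⟩

variable (K) in
theorem exact_subtype_toCyclesModule (n : ℤ) :
    Function.Exact (LinearMap.ker (K.d n (n + 1)).hom).subtype (toCyclesModule K n) := by
  intro x
  constructor
  · intro hx
    exact ⟨⟨x, congrArg Subtype.val hx⟩, rfl⟩
  · rintro ⟨y, rfl⟩
    exact Subtype.ext y.2

theorem cyclesSequence_shortExact (hK : K.Acyclic) (n : ℤ) : (cyclesSequence K n).ShortExact :=
  ModuleCat.shortComplex_shortExact _ (exact_subtype_toCyclesModule K n) Subtype.val_injective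
    (toCyclesModule_surjective hK n)

theorem range_d_eq_ker (hK : K.Acyclic) :
    LinearMap.range (K.d (-1) 0).hom = LinearMap.ker (K.d 0 (0 + 1)).hom :=
  ((acyclic_iff_exact.1 hK (-1)).linearMap_ker_eq).symm

theorem exactAfter_tensor_of_injective (hK : K.Acyclic) {X : ModuleCat.{u} R}
    (h : ∀ n, Function.Injective ((LinearMap.ker (K.d n (n + 1)).hom).subtype.lTensor X)) :
    ExactAfter (tensorFunctor X) K := by
  rw [exactAfter_tensorFunctor_iff]
  intro n
  have hd : ∀ m, (K.d m (m + 1)).hom.lTensor X =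
      ((LinearMap.ker (K.d (m + 1) (m + 1 + 1)).hom).subtype.lTensor X).comp
        ((toCyclesModule K m).lTensor X) :=
    fun m => by
      rw [← LinearMap.lTensor_comp, toCyclesModule, LinearMap.subtype_comp_codRestrict]
  have hsurj : Function.Surjective ((toCyclesModule K n).lTensor X) :=
    LinearMap.lTensor_surjective X (toCyclesModule_surjective hK n)
  have hex : Function.Exact ((LinearMap.ker (K.d (n + 1) (n + 1 + 1)).hom).subtype.lTensor X)
      ((toCyclesModule K (n + 1)).lTensor X) :=
    lTensor_exact X (exact_subtype_toCyclesModule K (n + 1)) (toCyclesModule_surjective hK (n + 1))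
  rw [hd n, hd (n + 1)]
  intro x
  rw [LinearMap.comp_apply]
  refine ((map_eq_zero_iff _ (h (n + 1 + 1))).trans (hex x)).trans ?_
  constructor
  · rintro ⟨y, rfl⟩
    obtain ⟨w, rfl⟩ := hsurj y
    exact ⟨w, rfl⟩
  · rintro ⟨w, rfl⟩
    exact ⟨_, rfl⟩

end Complex

end Foxby

namespace Foxby

variable {R : Type u} [CommRing R] {C : ModuleCat.{u} R}

/-! ### Transferring exactness and maps along C ⊗ - -/

section Transfer

variable {C J I A B D : Type u} [AddCommGroup C] [Module R C] [AddCommGroup J] [Module R J]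
  [AddCommGroup I] [Module R I] [AddCommGroup A] [Module R A] [AddCommGroup B] [Module R B]
  [AddCommGroup D] [Module R D]

theorem exact_lTensor_lTensor_iff (e : J ⊗[R] C ≃ₗ[R] I) (f : A →ₗ[R] B) (g : B →ₗ[R] D) :
    Function.Exact ((f.lTensor C).lTensor J) ((g.lTensor C).lTensor J) ↔
      Function.Exact (f.lTensor I) (g.lTensor I) := by
  let E (X : Type u) [AddCommGroup X] [Module R X] : J ⊗[R] (C ⊗[R] X) ≃ₗ[R] I ⊗[R] X :=
    (TensorProduct.assoc R J C X).symm ≪≫ₗ LinearEquiv.rTensor X e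
  exact (Function.Exact.iff_of_ladder_linearEquiv (e₁ := E A) (e₂ := E B) (e₃ := E D)
    (by ext; simp [E]) (by ext; simp [E])).symm

/-- Hom(C ⊗ A, C ⊗ B) ≅ Hom(A, Hom(C, C ⊗ B)) ≅ Hom(A, B). -/
theorem exists_eq_lTensor (hB : Function.Bijective (tensorUnit R C B))
    (k : C ⊗[R] A →ₗ[R] C ⊗[R] B) : ∃ φ : A →ₗ[R] B, φ.lTensor C = k := by
  let e := LinearEquiv.ofBijective _ hB
  refine ⟨e.symm.toLinearMap.comp (TensorProduct.curry k).flip, ?_⟩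
  ext c a
  have h : tensorUnit R C B (e.symm ((TensorProduct.curry k).flip a)) =
      (TensorProduct.curry k).flip a := e.apply_symm_apply _
  exact LinearMap.congr_fun h c

theorem lTensor_eq_zero (hB : Function.Injective (tensorUnit R C B)) {φ : A →ₗ[R] B}
    (h : φ.lTensor C = 0) : φ = 0 := by
  ext a
  refine hB ?_
  rw [tensorUnit_naturality, h]
  simp

end Transfer

theorem IsSemidualizing.exists_tensor_equiv_injective (hC : IsSemidualizing C)
    (I : Type u) [AddCommGroup I] [Module R I] [Module.Injective R I] :
    Nonempty ((C →ₗ[R] I) ⊗[R] C ≃ₗ[R] I) :=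
  ⟨(TensorProduct.comm R _ _).trans
    (LinearEquiv.ofBijective _ (hC.tensorCounit_bijective_of_injective I))⟩

/-! ### From flat complexes to C-flat complexes -/

section FlatToCFlat

variable {K : CochainComplex (ModuleCat.{u} R) ℤ}

theorem IsSemidualizing.torVanish_cyclesModule (hC : IsSemidualizing C) (hK : K.Acyclic)
    (hF : ∀ n, Module.Flat R (K.X n)) (h₀ : auslanderClass C (cyclesModule K 0)) (n : ℤ) :
    TorVanish C (cyclesModule K n) := by
  have hflat : ∀ n, auslanderClass C (K.X n) := fun n => hC.auslanderClass_of_flat (K.X n)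
  rcases le_total 0 n with hn | hn
  · refine And.left (?_ : auslanderClass C (cyclesModule K n))
    induction n, hn using Int.leInduction with
    | base => exact h₀
    | succ n _ ih => exact hC.auslanderClass_X₃ (cyclesSequence_shortExact hK n) ih (hflat n)
  · induction n, hn using Int.leInductionDown with
    | base => exact h₀.1
    | pred n _ ih =>
      refine TorVanish.X₁ (cyclesSequence_shortExact hK (n - 1)) (hflat (n - 1)).1 ?_
      have hn : n - 1 + 1 = n := by lia
      change TorVanish C (cyclesModule K (n - 1 + 1))
      rw [hn]
      exact ih

theorem lTensor_subtype_injective (hK : K.Acyclic) (n : ℤ)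
    (h : TorVanish C (cyclesModule K (n + 1))) :
    Function.Injective ((LinearMap.ker (K.d n (n + 1)).hom).subtype.lTensor C) :=
  lTensor_injective_of_torVanish (S := cyclesSequence K n) (cyclesSequence_shortExact hK n) h

theorem IsSemidualizing.exactAfter_tensor (hC : IsSemidualizing C) (hK : K.Acyclic)
    (hF : ∀ n, Module.Flat R (K.X n)) (h₀ : auslanderClass C (cyclesModule K 0)) :
    ExactAfter (tensorFunctor C) K := by
  refine exactAfter_tensor_of_injective hK fun n => ?_
  exact lTensor_subtype_injective hK n (hC.torVanish_cyclesModule hK hF h₀ (n + 1))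

theorem range_lTensor_equiv {M A B : Type u} [AddCommGroup M] [Module R M] [AddCommGroup A]
    [Module R A] [AddCommGroup B] [Module R B] (f : A →ₗ[R] B) (e : M ≃ₗ[R] LinearMap.range f)
    (hinj : Function.Injective ((LinearMap.range f).subtype.lTensor C)) :
    Nonempty (C ⊗[R] M ≃ₗ[R] LinearMap.range (f.lTensor C)) := by
  have hrange : LinearMap.range ((LinearMap.range f).subtype.lTensor C) =
      LinearMap.range (f.lTensor C) := by
    have h : f.lTensor C = ((LinearMap.range f).subtype.lTensor C).comp
        (f.rangeRestrict.lTensor C) := by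
      rw [← LinearMap.lTensor_comp]
      rfl
    rw [h, LinearMap.range_comp_of_range_eq_top]
    exact LinearMap.range_eq_top.2
      (LinearMap.lTensor_surjective C f.surjective_rangeRestrict)
  exact ⟨(LinearEquiv.lTensor C e).trans
    ((LinearEquiv.ofInjective _ hinj).trans (LinearEquiv.ofEq _ _ hrange))⟩

/-- Every map in sight is C ⊗ φ for a unique φ, so the problem becomes lifting P → Zⁿ⁺¹ through Kⁿ,
which projectivity of `P` solves. -/
theorem exists_lift_lTensor (hK : K.Acyclic)
    (hunit : ∀ n, Function.Bijective (tensorUnit R C (K.X n))) {P : Type u} [AddCommGroup P]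
    [Module R P] [Module.Projective R P] (n : ℤ) (f : C ⊗[R] P →ₗ[R] C ⊗[R] K.X (n + 1))
    (hf : ((K.d (n + 1) (n + 1 + 1)).hom.lTensor C).comp f = 0) :
    ∃ g : C ⊗[R] P →ₗ[R] C ⊗[R] K.X n, ((K.d n (n + 1)).hom.lTensor C).comp g = f := by
  obtain ⟨φ, rfl⟩ := exists_eq_lTensor (hunit (n + 1)) f
  have hdφ : (K.d (n + 1) (n + 1 + 1)).hom.comp φ = 0 := by
    apply lTensor_eq_zero (hunit (n + 1 + 1)).1
    rw [LinearMap.lTensor_comp, hf]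
  obtain ⟨ψ, hψ⟩ := Module.projective_lifting_property (toCyclesModule K n)
    (φ.codRestrict _ fun x => LinearMap.mem_ker.2 (LinearMap.congr_fun hdφ x))
    (toCyclesModule_surjective hK n)
  refine ⟨ψ.lTensor C, ?_⟩
  rw [← LinearMap.lTensor_comp]
  congr 1
  ext x
  exact congrArg Subtype.val (LinearMap.congr_fun hψ x)

theorem exactAfter_homFunctor_tensor (hK : K.Acyclic)
    (hunit : ∀ n, Function.Bijective (tensorUnit R C (K.X n))) {X : ModuleCat.{u} R}
    (hX : cProjective C X) : ExactAfter (homFunctor X)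
      (((tensorFunctor C).mapHomologicalComplex (ComplexShape.up ℤ)).obj K) := by
  obtain ⟨P, hP, ⟨e⟩⟩ := hX
  have key : ∀ (n : ℤ) (f : X →ₗ[R] C ⊗[R] K.X (n + 1)),
      ((K.d (n + 1) (n + 1 + 1)).hom.lTensor C).comp f = 0 →
      ∃ g : X →ₗ[R] C ⊗[R] K.X n, ((K.d n (n + 1)).hom.lTensor C).comp g = f := by
    intro n f hf
    obtain ⟨g, hg⟩ := exists_lift_lTensor hK hunit n (f.comp e.symm.toLinearMap) (by
      rw [← LinearMap.comp_assoc, hf, LinearMap.zero_comp])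
    refine ⟨g.comp e.toLinearMap, ?_⟩
    rw [← LinearMap.comp_assoc, hg]
    ext x
    simp
  exact exactAfter_homFunctor_iff.2 key

theorem IsSemidualizing.exactAfter_tensor_tensor (hC : IsSemidualizing C)
    (hI : ∀ I : ModuleCat.{u} R, Module.Injective R I → ExactAfter (tensorFunctor I) K)
    {J : ModuleCat.{u} R} (hJ : cInjective C J) : ExactAfter (tensorFunctor J)
      (((tensorFunctor C).mapHomologicalComplex (ComplexShape.up ℤ)).obj K) := by
  obtain ⟨I, hI', ⟨e⟩⟩ := hJ
  obtain ⟨e₀⟩ := hC.exists_tensor_equiv_injective I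
  refine exactAfter_tensorFunctor_iff.2 fun n => ?_
  exact (exact_lTensor_lTensor_iff ((LinearEquiv.rTensor C e).trans e₀)
    (K.d n (n + 1)).hom (K.d (n + 1) (n + 1 + 1)).hom).2
      (exactAfter_tensorFunctor_iff.1 (hI I hI') n)

theorem IsSemidualizing.wfGorenstein_tensor (hC : IsSemidualizing C) {M : ModuleCat.{u} R}
    (hM : gorensteinFlat R M) (hM' : auslanderClass C M) :
    wfGorenstein C ((tensorFunctor C).obj M) := by
  obtain ⟨K, hK, hF, ⟨e⟩, hI⟩ := hM
  have hunit : ∀ n, Function.Bijective (tensorUnit R C (K.X n)) := fun n =>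
    hC.tensorUnit_bijective_of_flat (K.X n)
  have h₀ : auslanderClass C (cyclesModule K 0) :=
    hM'.of_linearEquiv (e.trans (LinearEquiv.ofEq _ _ (range_d_eq_ker hK)))
  have hCK : ExactAfter (tensorFunctor C) K := hC.exactAfter_tensor hK hF h₀
  have hr : auslanderClass C (ModuleCat.of R (LinearMap.range (K.d (-1) 0).hom)) :=
    hM'.of_linearEquiv e
  exact ⟨((tensorFunctor C).mapHomologicalComplex (ComplexShape.up ℤ)).obj K, hCK,
    fun n => ⟨K.X n, hF n, ⟨LinearEquiv.refl R _⟩⟩,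
    range_lTensor_equiv _ e
      (hC.lTensor_injective _ Subtype.val_injective hr.2.2.2 (hunit 0).1),
    fun X hX => exactAfter_homFunctor_tensor hK hunit hX,
    fun J hJ => hC.exactAfter_tensor_tensor hI hJ⟩

end FlatToCFlat

/-! ### From C-flat complexes to flat complexes -/

section CFlatToFlat

variable {W : CochainComplex (ModuleCat.{u} R) ℤ}

theorem IsSemidualizing.tensorCounit_bijective_of_cFlat (hC : IsSemidualizing C)
    {Y : ModuleCat.{u} R} (hY : cFlat C Y) : Function.Bijective (tensorCounit R C Y) := by
  obtain ⟨F, hF, ⟨e⟩⟩ := hY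
  exact tensorCounit_bijective_congr e.symm
    (tensorCounit_bijective_of_tensorUnit (hC.tensorUnit_bijective_of_flat F))

theorem IsSemidualizing.flat_hom_of_cFlat (hC : IsSemidualizing C)
    {Y : ModuleCat.{u} R} (hY : cFlat C Y) : Module.Flat R (C →ₗ[R] Y) := by
  obtain ⟨F, hF, ⟨e⟩⟩ := hY
  exact Module.Flat.of_linearEquiv ((LinearEquiv.congrRight e).trans
    (LinearEquiv.ofBijective _ (hC.tensorUnit_bijective_of_flat F)).symm)

theorem IsSemidualizing.extVanish_of_cFlat (hC : IsSemidualizing C)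
    {Y : ModuleCat.{u} R} (hY : cFlat C Y) : ExtVanish C Y := by
  obtain ⟨F, hF, ⟨e⟩⟩ := hY
  exact (hC.extVanish_of_flat F).of_iso e.symm.toModuleIso

theorem cProjective_self (C : ModuleCat.{u} R) : cProjective C C :=
  ⟨ModuleCat.of R R, inferInstanceAs (Module.Projective R R), ⟨(TensorProduct.rid R C).symm⟩⟩

theorem exists_lift_of_exactAfter {X : ModuleCat.{u} R} (hW : ExactAfter (homFunctor X) W)
    {i j k : ℤ} (hij : i + 1 = j) (hjk : j + 1 = k) (f : X →ₗ[R] W.X j)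
    (hf : (W.d j k).hom.comp f = 0) : ∃ g : X →ₗ[R] W.X i, (W.d i j).hom.comp g = f := by
  subst hij hjk
  exact exactAfter_homFunctor_iff.1 hW i f hf

theorem exists_lift_toCyclesModule (hW : ExactAfter (homFunctor C) W) (n : ℤ)
    (f : C →ₗ[R] LinearMap.ker (W.d (n + 1) (n + 1 + 1)).hom) :
    ∃ g : C →ₗ[R] W.X n, (toCyclesModule W n).comp g = f := by
  obtain ⟨g, hg⟩ := exactAfter_homFunctor_iff.1 hW n ((Submodule.subtype _).comp f) (by
    ext x
    exact (f x).2)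
  exact ⟨g, LinearMap.ext fun x => Subtype.ext (LinearMap.congr_fun hg x)⟩

variable (C W) in
/-- The sequence `0 → Hom(C, Zⁿ) → Hom(C, Wⁿ) → Hom(C, Zⁿ⁺¹) → 0`. -/
abbrev homCyclesSequence (n : ℤ) : ShortComplex (ModuleCat.{u} R) where
  X₁ := ModuleCat.of R (C →ₗ[R] LinearMap.ker (W.d n (n + 1)).hom)
  X₂ := ModuleCat.of R (C →ₗ[R] W.X n)
  X₃ := ModuleCat.of R (C →ₗ[R] LinearMap.ker (W.d (n + 1) (n + 1 + 1)).hom)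
  f := ModuleCat.ofHom (((LinearMap.ker (W.d n (n + 1)).hom).subtype.compRight R :
    (C →ₗ[R] LinearMap.ker (W.d n (n + 1)).hom) →ₗ[R] C →ₗ[R] W.X n))
  g := ModuleCat.ofHom (((toCyclesModule W n).compRight R :
    (C →ₗ[R] W.X n) →ₗ[R] C →ₗ[R] LinearMap.ker (W.d (n + 1) (n + 1 + 1)).hom))
  zero := by
    refine ModuleCat.hom_ext (LinearMap.ext fun f => LinearMap.ext fun c => ?_)
    exact (exact_subtype_toCyclesModule W n).apply_apply_eq_zero (f c)

theorem homCyclesSequence_shortExact (hW : ExactAfter (homFunctor C) W) (n : ℤ) :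
    (homCyclesSequence C W n).ShortExact := by
  refine ModuleCat.shortComplex_shortExact _ (fun f => ?_) (fun f g hfg => ?_)
    (exists_lift_toCyclesModule hW n)
  · constructor
    · intro hf
      have hf' : ∀ c, (W.d n (n + 1)).hom (f c) = 0 := fun c =>
        congrArg Subtype.val (LinearMap.congr_fun hf c)
      exact ⟨LinearMap.codRestrict _ f hf', rfl⟩
    · rintro ⟨g, rfl⟩
      exact LinearMap.ext fun c => (exact_subtype_toCyclesModule W n).apply_apply_eq_zero (g c)
  · refine LinearMap.ext fun c => Subtype.ext ?_
    exact LinearMap.congr_fun hfg c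

/-- Surjectivity descends from Wⁿ to Zⁿ⁺¹. For injectivity, lift an element of the kernel to C ⊗
Hom(C, Wⁿ); its counit lies in Zⁿ, so by surjectivity there the lift comes from C ⊗ Hom(C, Zⁿ) and
dies. -/
theorem tensorCounit_bijective_cyclesModule (hW : W.Acyclic) (hCW : ExactAfter (homFunctor C) W)
    (hε : ∀ n, Function.Bijective (tensorCounit R C (W.X n))) (n : ℤ) :
    Function.Bijective (tensorCounit R C (LinearMap.ker (W.d n (n + 1)).hom)) := by
  have hsurj : ∀ n, Function.Surjective
      (tensorCounit R C (LinearMap.ker (W.d (n + 1) (n + 1 + 1)).hom)) := by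
    intro n z
    obtain ⟨w, rfl⟩ := toCyclesModule_surjective hW n z
    obtain ⟨t, rfl⟩ := (hε n).2 w
    exact ⟨_, tensorCounit_naturality (toCyclesModule W n) t⟩
  suffices H : ∀ n, Function.Bijective
      (tensorCounit R C (LinearMap.ker (W.d (n + 1) (n + 1 + 1)).hom)) by
    have := H (n - 1)
    have hn : n - 1 + 1 = n := by lia
    rwa [hn] at this
  intro n
  refine ⟨(injective_iff_map_eq_zero _).2 fun z hz => ?_, hsurj n⟩
  obtain ⟨w, rfl⟩ := LinearMap.lTensor_surjective C
    (homCyclesSequence_shortExact hCW n).moduleCat_surjective_g z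
  have h1 : toCyclesModule W n (tensorCounit R C (W.X n) w) = 0 :=
    (tensorCounit_naturality (toCyclesModule W n) w).symm.trans hz
  obtain ⟨y, hy⟩ := (exact_subtype_toCyclesModule W n _).1 h1
  have hsurj' : Function.Surjective (tensorCounit R C (LinearMap.ker (W.d n (n + 1)).hom)) := by
    have := hsurj (n - 1)
    have hn : n - 1 + 1 = n := by lia
    rwa [hn] at this
  obtain ⟨t, rfl⟩ := hsurj' y
  have h2 := (hε n).1 ((tensorCounit_naturality _ t).trans hy)
  rw [← h2, ← LinearMap.comp_apply, ← LinearMap.lTensor_comp]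
  have h3 : ((toCyclesModule W n).compRight R : (C →ₗ[R] W.X n) →ₗ[R] _).comp
      ((Submodule.subtype _).compRight R) = 0 :=
    congrArg ModuleCat.Hom.hom (homCyclesSequence C W n).zero
  exact LinearMap.congr_fun ((congrArg (LinearMap.lTensor C) h3).trans (LinearMap.lTensor_zero _)) t

/-- The counits identify this map with the inclusion Zⁿ → Wⁿ. -/
theorem lTensor_homCyclesSequence_injective (hW : W.Acyclic)
    (hCW : ExactAfter (homFunctor C) W)
    (hε : ∀ n, Function.Bijective (tensorCounit R C (W.X n))) (n : ℤ) :
    Function.Injective ((homCyclesSequence C W n).f.hom.lTensor C) := by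
  intro x y hxy
  apply (tensorCounit_bijective_cyclesModule hW hCW hε n).1
  apply Subtype.val_injective
  have h := congrArg (tensorCounit R C (W.X n)) hxy
  exact (tensorCounit_naturality _ x).symm.trans (h.trans (tensorCounit_naturality _ y))

/-- Ext¹ vanishes because maps C → Zⁿ⁺¹ lift to Wⁿ; higher Ext of Zⁿ shifts to lower Ext of Zⁿ⁺¹. -/
theorem extVanish_cyclesModule (hW : W.Acyclic) (hCW : ExactAfter (homFunctor C) W)
    (hE : ∀ n, ExtVanish C (W.X n)) (n : ℤ) : ExtVanish C (cyclesModule W n) := by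
  rw [extVanish_iff_succ]
  intro i
  induction i generalizing n with
  | zero =>
    refine subsingleton_ext_one_right_X₁ (cyclesSequence_shortExact hW n) (fun f => ?_)
      (hE n 1 le_rfl)
    obtain ⟨g, hg⟩ := exists_lift_toCyclesModule hCW n f.hom
    exact ⟨ModuleCat.ofHom g, ModuleCat.hom_ext hg⟩
  | succ i ih =>
    exact subsingleton_ext_right_X₁ (cyclesSequence_shortExact hW n) (i + 1)
      (hE n _ (by lia)) (ih (n + 1))

theorem torVanish_hom_cyclesModule (hW : W.Acyclic) (hCW : ExactAfter (homFunctor C) W)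
    (hε : ∀ n, Function.Bijective (tensorCounit R C (W.X n)))
    (hF : ∀ n, Module.Flat R (C →ₗ[R] W.X n)) (n : ℤ) :
    TorVanish C (ModuleCat.of R (C →ₗ[R] LinearMap.ker (W.d n (n + 1)).hom)) := by
  suffices H : ∀ (i : ℕ) (n : ℤ), Limits.IsZero (((Tor (ModuleCat.{u} R) (i + 1)).obj C).obj
      (ModuleCat.of R (C →ₗ[R] LinearMap.ker (W.d n (n + 1)).hom))) by
    intro i hi
    obtain ⟨j, rfl⟩ := Nat.exists_eq_add_of_le' hi
    exact H j n
  intro i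
  induction i with
  | zero =>
    intro n
    -- Tor shifts to the left, so the module must be the last term of its sequence.
    obtain ⟨m, rfl⟩ : ∃ m, n = m + 1 := ⟨n - 1, by lia⟩
    exact isZero_tor_one_X₃ (homCyclesSequence_shortExact hCW m)
      (torVanish_of_flat C (ModuleCat.of R (C →ₗ[R] W.X m)))
      (lTensor_homCyclesSequence_injective hW hCW hε m)
  | succ i ih =>
    intro n
    obtain ⟨m, rfl⟩ : ∃ m, n = m + 1 := ⟨n - 1, by lia⟩
    exact isZero_tor_succ_X₃ (homCyclesSequence_shortExact hCW m)
      (torVanish_of_flat C (ModuleCat.of R (C →ₗ[R] W.X m))) i (ih m)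

variable {N : ModuleCat.{u} R}

theorem IsSemidualizing.tensorCounit_bijective_of_wfGorenstein (hC : IsSemidualizing C)
    (hN : wfGorenstein C N) : Function.Bijective (tensorCounit R C N) := by
  obtain ⟨W, hW, hF, ⟨e⟩, hP, -⟩ := hN
  exact tensorCounit_bijective_congr
    (e.trans (LinearEquiv.ofEq _ _ (range_d_eq_ker hW))).symm
    (tensorCounit_bijective_cyclesModule hW (hP C (cProjective_self C))
      (fun n => hC.tensorCounit_bijective_of_cFlat (hF n)) 0)

theorem IsSemidualizing.auslanderClass_hom_of_wfGorenstein (hC : IsSemidualizing C)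
    (hN : wfGorenstein C N) : auslanderClass C (ModuleCat.of R (C →ₗ[R] N)) := by
  have hε := hC.tensorCounit_bijective_of_wfGorenstein hN
  obtain ⟨W, hW, hF, ⟨e⟩, hP, -⟩ := hN
  have hCW := hP C (cProjective_self C)
  let e₀ : N ≃ₗ[R] cyclesModule W 0 := e.trans (LinearEquiv.ofEq _ _ (range_d_eq_ker hW))
  refine ⟨?_, ?_, tensorUnit_bijective_of_tensorCounit hε⟩
  · exact (torVanish_hom_cyclesModule hW hCW
      (fun n => hC.tensorCounit_bijective_of_cFlat (hF n))
      (fun n => hC.flat_hom_of_cFlat (hF n)) 0).of_iso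
      (LinearEquiv.congrRight e₀.symm).toModuleIso
  -- The counit replaces C ⊗ Hom(C, N) by N, and N is Z⁰.
  · exact (extVanish_cyclesModule hW hCW (fun n => hC.extVanish_of_cFlat (hF n)) 0).of_iso
      (e₀.symm.trans (LinearEquiv.ofBijective _ hε).symm).toModuleIso

theorem IsSemidualizing.gorensteinFlat_hom_of_wfGorenstein (hC : IsSemidualizing C)
    (hN : wfGorenstein C N) : gorensteinFlat R ((homFunctor C).obj N) := by
  obtain ⟨W, hW, hF, ⟨e⟩, hP, hJ⟩ := hN
  have hCW := hP C (cProjective_self C)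
  refine ⟨((homFunctor C).mapHomologicalComplex (ComplexShape.up ℤ)).obj W, hCW, fun n => ?_,
    ?_, fun I hI => ?_⟩
  · have := hC.flat_hom_of_cFlat (hF n)
    exact Module.Flat.of_linearEquiv
      (ModuleCat.homLinearEquiv (S := R) : (C ⟶ W.X n) ≃ₗ[R] (C →ₗ[R] W.X n))
  · let f := (W.d (-1) 0).hom
    let T : (C →ₗ[R] LinearMap.range f) →ₗ[R] (C ⟶ W.X 0) :=
      (ModuleCat.homLinearEquiv (S := R)).symm.toLinearMap.comp
        ((LinearMap.range f).subtype.compRight R)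
    have hT : Function.Injective T := by
      refine (ModuleCat.homLinearEquiv (S := R)).symm.injective.comp fun g g' h => ?_
      ext c
      exact LinearMap.congr_fun h c
    -- Maps from C into the image of d⁻¹ lift to W⁻¹ because Hom(C, W) is exact, so Hom(C, -)
    -- commutes with taking this image.
    have hrange : LinearMap.range T = LinearMap.range
        ((((homFunctor C).mapHomologicalComplex (ComplexShape.up ℤ)).obj W).d (-1) 0).hom := by
      apply le_antisymm
      · rintro _ ⟨g, rfl⟩
        obtain ⟨k, hk⟩ := exists_lift_of_exactAfter hCW (i := -1) (j := 0) (k := 1) rfl rfl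
          ((LinearMap.range f).subtype.comp g) (by
            ext c
            obtain ⟨w, hw⟩ := (g c).2
            exact (congrArg _ hw.symm).trans
              (LinearMap.congr_fun (congrArg ModuleCat.Hom.hom (W.d_comp_d (-1) 0 1)) w))
        exact ⟨ModuleCat.ofHom k, ModuleCat.hom_ext hk⟩
      · rintro _ ⟨k, rfl⟩
        have hk : ∀ k : C ⟶ W.X (-1), k ≫ W.d (-1) 0 ∈ LinearMap.range T := fun k =>
          ⟨f.rangeRestrict.comp k.hom, rfl⟩
        exact hk k
    exact ⟨((ModuleCat.homLinearEquiv (S := R) : (C ⟶ N) ≃ₗ[R] (C →ₗ[R] N)).trans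
      (LinearEquiv.congrRight e)).trans
        ((LinearEquiv.ofInjective T hT).trans (LinearEquiv.ofEq _ _ hrange))⟩
  -- I ⊗ Hom(C, W) ≅ Hom(C, I) ⊗ C ⊗ Hom(C, W) ≅ Hom(C, I) ⊗ W, which is exact by hypothesis.
  · obtain ⟨e₀⟩ := hC.exists_tensor_equiv_injective I
    let J := ModuleCat.of R (C →ₗ[R] I)
    have hJW := exactAfter_tensorFunctor_iff.1 (hJ J ⟨I, hI, ⟨LinearEquiv.refl R _⟩⟩)
    rw [exactAfter_tensorFunctor_iff]
    intro n
    let ε (n : ℤ) : J ⊗[R] (C ⊗[R] (C →ₗ[R] W.X n)) ≃ₗ[R] J ⊗[R] W.X n :=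
      LinearEquiv.lTensor J (LinearEquiv.ofBijective _ (hC.tensorCounit_bijective_of_cFlat (hF n)))
    have hnat : ∀ m n : ℤ, ((W.d m n).hom.lTensor J).comp (ε m).toLinearMap =
        (ε n).toLinearMap.comp ((((W.d m n).hom.compRight R).lTensor C).lTensor J) := by
      intro m n
      ext j c g
      rfl
    have h1 := (Function.Exact.iff_of_ladder_linearEquiv (hnat n (n + 1))
      (hnat (n + 1) (n + 1 + 1))).1 (hJW n)
    have h2 := (exact_lTensor_lTensor_iff e₀ _ _).1 h1
    let h (n : ℤ) : I ⊗[R] (C ⟶ W.X n) ≃ₗ[R] I ⊗[R] (C →ₗ[R] W.X n) :=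
      LinearEquiv.lTensor I (ModuleCat.homLinearEquiv (S := R))
    have hnat' : ∀ m n : ℤ, (((W.d m n).hom.compRight R).lTensor I).comp (h m).toLinearMap =
        (h n).toLinearMap.comp ((Linear.rightComp R C (W.d m n)).lTensor I) := by
      intro m n
      ext j g
      rfl
    exact (Function.Exact.iff_of_ladder_linearEquiv (hnat' n (n + 1))
      (hnat' (n + 1) (n + 1 + 1))).1 h2

theorem IsSemidualizing.auslanderClass_homFunctor (hC : IsSemidualizing C)
    (hN : wfGorenstein C N) : auslanderClass C ((homFunctor C).obj N) :=
  (hC.auslanderClass_hom_of_wfGorenstein hN).of_linearEquiv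
    (ModuleCat.homLinearEquiv (S := R) : (C ⟶ N) ≃ₗ[R] (C →ₗ[R] N)).symm

end CFlatToFlat

end Foxby

/-! ### The natural isomorphisms and the equivalence -/

namespace Foxby

variable {R : Type u} [CommRing R] {C : ModuleCat.{u} R}

/-- The unit `M ≅ Hom(C, C ⊗ M)` on the Auslander class. -/
noncomputable def unitIso {M : ModuleCat.{u} R} (hM : auslanderClass C M) :
    M ≅ (homFunctor C).obj ((tensorFunctor C).obj M) :=
  ((LinearEquiv.ofBijective (tensorUnit R C M) hM.2.2).trans
    (ModuleCat.homLinearEquiv (S := R) :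
      (C ⟶ (tensorFunctor C).obj M) ≃ₗ[R] (C →ₗ[R] (tensorFunctor C).obj M)).symm).toModuleIso

/-- The counit `C ⊗ Hom(C, N) ≅ N` on `W_F`-Gorenstein modules. -/
noncomputable def counitIso (hC : IsSemidualizing C) {N : ModuleCat.{u} R}
    (hN : wfGorenstein C N) : (tensorFunctor C).obj ((homFunctor C).obj N) ≅ N :=
  ((LinearEquiv.lTensor C
    (ModuleCat.homLinearEquiv (S := R) : (C ⟶ N) ≃ₗ[R] (C →ₗ[R] N))).trans
    (LinearEquiv.ofBijective (tensorCounit R C N)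
      (hC.tensorCounit_bijective_of_wfGorenstein hN))).toModuleIso

theorem unitIso_naturality {M M' : ModuleCat.{u} R} (hM : auslanderClass C M)
    (hM' : auslanderClass C M') (f : M ⟶ M') :
    f ≫ (unitIso hM').hom = (unitIso hM).hom ≫ (homFunctor C).map ((tensorFunctor C).map f) :=
  rfl

theorem counitIso_naturality (hC : IsSemidualizing C) {N N' : ModuleCat.{u} R}
    (hN : wfGorenstein C N) (hN' : wfGorenstein C N') (f : N ⟶ N') :
    (tensorFunctor C).map ((homFunctor C).map f) ≫ (counitIso hC hN').hom =
      (counitIso hC hN).hom ≫ f := by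
  refine ModuleCat.hom_ext (TensorProduct.ext' fun c g => ?_)
  rfl

end Foxby

theorem theorem3p5 {R : Type u} [CommRing R] (C : ModuleCat.{u} R)
    (hC : Foxby.IsSemidualizing C) :
    ∃ (hF : ∀ M : (Foxby.gorensteinFlat R ⊓ Foxby.auslanderClass C).FullSubcategory,
          Foxby.wfGorenstein C ((Foxby.tensorFunctor C).obj M.obj))
      (hG : ∀ N : (Foxby.wfGorenstein C).FullSubcategory,
          (Foxby.gorensteinFlat R ⊓ Foxby.auslanderClass C)
            ((Foxby.homFunctor C).obj N.obj))
      (e : (Foxby.gorensteinFlat R ⊓ Foxby.auslanderClass C).FullSubcategory ≌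
          (Foxby.wfGorenstein C).FullSubcategory),
      e.functor = (Foxby.wfGorenstein C).lift
          ((Foxby.gorensteinFlat R ⊓ Foxby.auslanderClass C).ι ⋙ Foxby.tensorFunctor C) hF ∧
      e.inverse = (Foxby.gorensteinFlat R ⊓ Foxby.auslanderClass C).lift
          ((Foxby.wfGorenstein C).ι ⋙ Foxby.homFunctor C) hG := by
  have hF : ∀ M : (Foxby.gorensteinFlat R ⊓ Foxby.auslanderClass C).FullSubcategory,
      Foxby.wfGorenstein C ((Foxby.tensorFunctor C).obj M.obj) :=
    fun M => hC.wfGorenstein_tensor M.property.1 M.property.2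
  have hG : ∀ N : (Foxby.wfGorenstein C).FullSubcategory,
      (Foxby.gorensteinFlat R ⊓ Foxby.auslanderClass C) ((Foxby.homFunctor C).obj N.obj) :=
    fun N => ⟨hC.gorensteinFlat_hom_of_wfGorenstein N.property,
      hC.auslanderClass_homFunctor N.property⟩
  refine ⟨hF, hG, CategoryTheory.Equivalence.mk
    ((Foxby.wfGorenstein C).lift
      ((Foxby.gorensteinFlat R ⊓ Foxby.auslanderClass C).ι ⋙ Foxby.tensorFunctor C) hF)
    ((Foxby.gorensteinFlat R ⊓ Foxby.auslanderClass C).lift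
      ((Foxby.wfGorenstein C).ι ⋙ Foxby.homFunctor C) hG)
    (NatIso.ofComponents
      (fun M => ObjectProperty.isoMk _ (Foxby.unitIso M.property.2)) ?_)
    (NatIso.ofComponents
      (fun N => ObjectProperty.isoMk _ (Foxby.counitIso hC N.property)) ?_), rfl, rfl⟩
  · intro M M' f
    exact ObjectProperty.hom_ext _ (Foxby.unitIso_naturality M.property.2 M'.property.2 f.hom)
  · intro N N' f
    exact ObjectProperty.hom_ext _ (Foxby.counitIso_naturality hC N.property N'.property f.hom)
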